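/- Fix the following notion of computation. A \emph{program} is a finite expression, containing no real constants except $0$ and $1$, that works on natural numbers, real numbers, pairs and finite lists. It is built by sequential composition, pairing of results, branching and while loops from these elementary operations: $+,-,\cdot,/$ and the comparison $\le$ on real numbers (division by $0$ gives no result); arithmetic of natural numbers; handling of pairs and lists; reading a single term $\mu_n$ or $\nu_n$ of two given real sequences; testing $n\preccurlyeq m$ for a single pair $(n,m)$ and a given relation $\preccurlyeq$. A program \emph{computes} $y$ from the input $x$ and the data $(\mu,\nu,\preccurlyeq)$ if, started on $x$, it halts with output $y$ after finitely many elementary operations. A finitely supported matrix is output as a finite list of pairs (position, value); its entry at a position is the first value listed there, and $0$ at positions not listed. \textbf{Theorem.} There are two programs $P$ and $Q$ such that the following holds for all sequences $\mu=(\mu_n)_{n\in\mathbb N}$, $\nu=(\nu_n)_{n\in\mathbb N}$ of nonnegative real numbers with $\sum_n\mu_n=\sum_n\nu_n=1$ and all partial orders $\preccurlyeq$ on $\mathbb N$ that satisfy \[ \sum_{n\in R}\mu_n\le\sum_{n\in R}\nu_n\quad\text{for every upward closed } R\subseteq\mathbb N. \] There are matrices $\Delta^{(k)}=(\delta^{(k)}_{n,m})_{n,m\in\mathbb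 N}$, $k\in\mathbb N$, in $\ell^1(\mathbb N\times\mathbb N)$ and $\Delta=(\delta_{n,m})_{n,m\in\mathbb N}\in\ell^1(\mathbb N\times\mathbb N)$ such that: \begin{enumerate} \item For each $k$, the program $P$ computes the (finitely supported) matrix $\Delta^{(k)}$ from the input $k$ and the data $(\mu,\nu,\preccurlyeq)$. \item $\Delta^{(k)}\to\Delta$ in the $\ell^1$-norm as $k\to\infty$; moreover $\delta_{n,m}\ge0$ for all $n,m$, $\sum_{n,m}\delta_{n,m}=1$, $\delta_{n,m}\ne0$ implies $n\preccurlyeq m$, $\sum_m\delta_{n,m}=\mu_n$ for all $n$, and $\sum_n\delta_{n,m}=\nu_m$ for all $m$. \item For all $n,m$ with $n\prec m$ and all real $\epsilon>0$, the program $Q$ computes from the input $(n,m,\epsilon)$ and the data $(\mu,\nu,\preccurlyeq)$ a number $k_0\in\mathbb N$ such that $|\delta^{(k)}_{n,m}-\delta_{n,m}|\le\epsilon$ for all $k\ge k_0$. \end{enumerate} -/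

import Mathlib

open Filter Topology

namespace AlgComp

/-- The given data: two sequences of real numbers and a binary relation on `ℕ`. -/
structure InputData where
  mu : ℕ → ℝ
  nu : ℕ → ℝ
  le : ℕ → ℕ → Prop

/-- Data types of programs: natural numbers, real numbers, pairs and finite lists. -/
inductive Ty : Type
  | nat : Ty
  | real : Ty
  | prod : Ty → Ty → Ty
  | list : Ty → Ty

/-- The values of a data type. -/
@[reducible] def Ty.Val : Ty → Type
  | .nat => ℕ
  | .real => ℝ
  | .prod a b => a.Val × b.Val
  | .list a => List a.Val

/-- Elementary operations from type `a` to type `b`.  The real constants are `0` and `1`; the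
operations on reals are the field operations and the comparison; `mu`, `nu` read one term of the
given sequences and `ord` tests the given relation on one pair of natural numbers.  The remaining
operations are arithmetic of natural numbers (indices) and data movement. -/
inductive Op : Ty → Ty → Type
  | rzero {a : Ty} : Op a .real
  | rone {a : Ty} : Op a .real
  | radd : Op (.prod .real .real) .real
  | rsub : Op (.prod .real .real) .real
  | rmul : Op (.prod .real .real) .real
  | rdiv : Op (.prod .real .real) .real
  | rle : Op (.prod .real .real) .nat
  | mu : Op .nat .real
  | nu : Op .nat .real
  | ord : Op (.prod .nat .nat) .nat
  | nzero {a : Ty} : Op a .nat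
  | nsucc : Op .nat .nat
  | nadd : Op (.prod .nat .nat) .nat
  | nmonus : Op (.prod .nat .nat) .nat
  | nmul : Op (.prod .nat .nat) .nat
  | id {a : Ty} : Op a a
  | fst {a b : Ty} : Op (.prod a b) a
  | snd {a b : Ty} : Op (.prod a b) b
  | nil {a b : Ty} : Op a (.list b)
  | cons {a : Ty} : Op (.prod a (.list a)) (.list a)
  | tail {a : Ty} : Op (.list a) (.list a)
  | length {a : Ty} : Op (.list a) .nat
  | get {a : Ty} : Op (.prod (.list a) .nat) a

open Classical in
/-- The result of an elementary operation; `none` for a division by zero and for the access to a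
list outside its range.  Tests return `1` for true and `0` for false. -/
noncomputable def Op.eval (D : InputData) : {a b : Ty} → Op a b → a.Val → Option b.Val
  | _, _, .rzero, _ => some (0 : ℝ)
  | _, _, .rone, _ => some (1 : ℝ)
  | _, _, .radd, x => some (x.1 + x.2 : ℝ)
  | _, _, .rsub, x => some (x.1 - x.2 : ℝ)
  | _, _, .rmul, x => some (x.1 * x.2 : ℝ)
  | _, _, .rdiv, x => if (x.2 : ℝ) = 0 then none else some (x.1 / x.2 : ℝ)
  | _, _, .rle, x => some (if (x.1 : ℝ) ≤ x.2 then (1 : ℕ) else (0 : ℕ))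
  | _, _, .mu, n => some (D.mu n)
  | _, _, .nu, n => some (D.nu n)
  | _, _, .ord, x => some (if D.le x.1 x.2 then (1 : ℕ) else (0 : ℕ))
  | _, _, .nzero, _ => some (0 : ℕ)
  | _, _, .nsucc, n => some (n + 1 : ℕ)
  | _, _, .nadd, x => some (x.1 + x.2 : ℕ)
  | _, _, .nmonus, x => some (x.1 - x.2 : ℕ)
  | _, _, .nmul, x => some (x.1 * x.2 : ℕ)
  | _, _, .id, x => some x
  | _, _, .fst, x => some x.1
  | _, _, .snd, x => some x.2
  | _, _, .nil, _ => some []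
  | _, _, .cons, x => some (x.1 :: x.2)
  | _, _, .tail, l => some (List.tail l)
  | _, _, .length, l => some (List.length l)
  | _, _, .get, x => x.1[x.2]?

/-- Programs with input of type `a` and output of type `b`: elementary operations, sequential
composition, pairing of two results, branching on a test, and while loops.  A program is a finite
object that contains no real number. -/
inductive Prog : Ty → Ty → Type
  | op {a b : Ty} (o : Op a b) : Prog a b
  | seq {a b c : Ty} (p : Prog a b) (q : Prog b c) : Prog a c
  | pair {a b c : Ty} (p : Prog a b) (q : Prog a c) : Prog a (.prod b c)
  | ite {a b : Ty} (c : Prog a .nat) (p q : Prog a b) : Prog a b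
  | while {a : Ty} (c : Prog a .nat) (p : Prog a a) : Prog a a

/-- `Run D p x y t`: the program `p`, with access to the data `D` and started on the input `x`,
halts with the output `y` after having performed exactly `t` elementary operations. -/
inductive Run (D : InputData) : {a b : Ty} → Prog a b → a.Val → b.Val → ℕ → Prop
  | op {a b : Ty} {o : Op a b} {x : a.Val} {y : b.Val} (h : o.eval D x = some y) :
      Run D (.op o) x y 1
  | seq {a b c : Ty} {p : Prog a b} {q : Prog b c} {x : a.Val} {y : b.Val} {z : c.Val} {s t : ℕ}
      (hp : Run D p x y s) (hq : Run D q y z t) : Run D (.seq p q) x z (s + t)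
  | pair {a b c : Ty} {p : Prog a b} {q : Prog a c} {x : a.Val} {y : b.Val} {z : c.Val} {s t : ℕ}
      (hp : Run D p x y s) (hq : Run D q x z t) : Run D (.pair p q) x (y, z) (s + t)
  | ite_true {a b : Ty} {c : Prog a .nat} {p q : Prog a b} {x : a.Val} {y : b.Val} {v : ℕ}
      {s t : ℕ} (hc : Run D c x v s) (hv : v ≠ 0) (hp : Run D p x y t) :
      Run D (.ite c p q) x y (s + t)
  | ite_false {a b : Ty} {c : Prog a .nat} {p q : Prog a b} {x : a.Val} {y : b.Val} {v : ℕ}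
      {s t : ℕ} (hc : Run D c x v s) (hv : v = 0) (hq : Run D q x y t) :
      Run D (.ite c p q) x y (s + t)
  | while_stop {a : Ty} {c : Prog a .nat} {p : Prog a a} {x : a.Val} {v s : ℕ}
      (hc : Run D c x v s) (hv : v = 0) : Run D (.while c p) x x s
  | while_step {a : Ty} {c : Prog a .nat} {p : Prog a a} {x y z : a.Val} {v s t u : ℕ}
      (hc : Run D c x v s) (hv : v ≠ 0) (hp : Run D p x y t) (hw : Run D (.while c p) y z u) :
      Run D (.while c p) x z (s + t + u)

/-- Programs are deterministic: output and number of operations are determined by the input. -/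
theorem Run.det {D : InputData} {a b : Ty} {p : Prog a b} {x : a.Val} {y y' : b.Val} {t t' : ℕ}
    (h : Run D p x y t) (h' : Run D p x y' t') : y = y' ∧ t = t' := by
  induction h generalizing t' with
  | op h =>
    cases h' with
    | op h'' => exact ⟨Option.some.inj (h.symm.trans h''), rfl⟩
  | seq _ _ ihp ihq =>
    cases h' with
    | seq hp hq =>
      obtain ⟨rfl, rfl⟩ := ihp hp
      obtain ⟨rfl, rfl⟩ := ihq hq
      exact ⟨rfl, rfl⟩
  | pair _ _ ihp ihq =>
    cases h' with
    | pair hp hq =>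
      obtain ⟨rfl, rfl⟩ := ihp hp
      obtain ⟨rfl, rfl⟩ := ihq hq
      exact ⟨rfl, rfl⟩
  | ite_true _ hv _ ihc ihp =>
    cases h' with
    | ite_true hc _ hp =>
      obtain ⟨rfl, rfl⟩ := ihc hc
      obtain ⟨rfl, rfl⟩ := ihp hp
      exact ⟨rfl, rfl⟩
    | ite_false hc hv' _ => exact absurd ((ihc hc).1.trans hv') hv
  | ite_false _ hv _ ihc ihq =>
    cases h' with
    | ite_false hc _ hq =>
      obtain ⟨rfl, rfl⟩ := ihc hc
      obtain ⟨rfl, rfl⟩ := ihq hq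
      exact ⟨rfl, rfl⟩
    | ite_true hc hv' _ => exact absurd ((ihc hc).1.symm.trans hv) hv'
  | while_stop _ hv ihc =>
    cases h' with
    | while_stop hc _ => exact ⟨rfl, (ihc hc).2⟩
    | while_step hc hv' _ _ => exact absurd ((ihc hc).1.symm.trans hv) hv'
  | while_step _ hv _ _ ihc ihp ihw =>
    cases h' with
    | while_stop hc hv' => exact absurd ((ihc hc).1.trans hv') hv
    | while_step hc _ hp hw =>
      obtain ⟨rfl, rfl⟩ := ihc hc
      obtain ⟨rfl, rfl⟩ := ihp hp
      obtain ⟨rfl, rfl⟩ := ihw hw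
      exact ⟨rfl, rfl⟩

/-- The data type of finite lists of pairs (position, value), positions being pairs of natural
numbers. -/
abbrev Ty.matrix : Ty := .list (.prod (.prod .nat .nat) .real)

/-- The entry at position `p` of the finitely supported matrix given by a list of pairs
(position, value): the (first) listed value at that position, and `0` if `p` is not listed. -/
noncomputable def entry (l : List ((ℕ × ℕ) × ℝ)) (p : ℕ × ℕ) : ℝ := (l.lookup p).getD 0

/-- `R` is upward closed with respect to the relation `le`. -/
def UpwardClosed (le : ℕ → ℕ → Prop) (R : Set ℕ) : Prop :=
  ∀ n ∈ R, ∀ m, le n m → m ∈ R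

end AlgComp

namespace AlgComp

open Finset

/-! Call a pair θ = (A, B) of finite sets with no a ≼ b (a in A, b in B) a cut. A solution has no
mass on A × B, so the mass it puts on the complement of A times the complement of B is exactly 1 -
μ(A) - ν(B). The hypothesis on upward closed sets, applied to the upper closure of A, makes this
number nonnegative. `slack` is what remains of it after some mass has been placed on strictly
increasing pairs.

Go through these pairs in the order of their codes and place on each the largest amount that no cut
forbids (`greedy`). All slacks stay nonnegative, so the masses left at the sources and targets
(`muRes`, `nuRes`) are nonnegative and still obey every cut inequality. By maximality, every pair n
≺ m is crossed by cuts of arbitrarily small limiting slack. Limiting slack is modular under (A ∪ A',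
B ∩ B'), (A ∩ A', B ∪ B'), and both combinations are again cuts. Hence nearly tight cuts can be
uncrossed into one that separates n from any finite set of elements strictly above it
(`exists_limSlack_le_forall`). Moving n into A then yields `muRes n ≤ nuRes n`. The totals agree, so
the two residues coincide, and placing them on the diagonal completes the solution.

The infimum over all cuts is not a finite computation. Cuts inside the first N numbers are finitely
many, and using only these changes the i-th amount by at most 2^i times the mass beyond N
(`abs_sub_greedy_le`). That mass is computable because both totals are 1, so a program can search
for an N that is good enough. This gives an explicit rate off the diagonal. Diagonal entries involve
infinite row sums of `greedy`; their convergence, and that in ℓ¹, comes from domination and carries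
no rate. -/

/-- The pair of natural numbers coded by `j` is strictly increasing for the given relation. -/
def Link (D : InputData) (j : ℕ) : Prop :=
  D.le j.unpair.1 j.unpair.2 ∧ j.unpair.1 ≠ j.unpair.2

/-- No element of the first set lies below an element of the second one. -/
def Indep (D : InputData) (θ : Finset ℕ × Finset ℕ) : Prop :=
  ∀ a ∈ θ.1, ∀ b ∈ θ.2, ¬ D.le a b

/-- The pair coded by `j` is strictly increasing and avoids `θ`. -/
def Cross (D : InputData) (j : ℕ) (θ : Finset ℕ × Finset ℕ) : Prop :=
  Link D j ∧ j.unpair.1 ∉ θ.1 ∧ j.unpair.2 ∉ θ.2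

open Classical in
/-- What `θ` still permits to be transported after the amounts `c j`, `j < i`. -/
noncomputable def slack (D : InputData) (c : ℕ → ℝ) (i : ℕ) (θ : Finset ℕ × Finset ℕ) : ℝ :=
  1 - ∑ a ∈ θ.1, D.mu a - ∑ b ∈ θ.2, D.nu b - ∑ j ∈ range i, if Cross D j θ then c j else 0

/-- Every `c i` is the largest amount that the members of `F` permit after `c j`, `j < i`. -/
def IsGreedy (D : InputData) (F : Set (Finset ℕ × Finset ℕ)) (c : ℕ → ℝ) : Prop :=
  ∀ i, (Link D i → IsGLB {x | ∃ θ ∈ F, Indep D θ ∧ Cross D i θ ∧ x = slack D c i θ} (c i)) ∧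
    (¬ Link D i → c i = 0)

/-- The hypotheses on the data. -/
structure Admissible (D : InputData) : Prop where
  refl : ∀ n, D.le n n
  antisymm : ∀ n m, D.le n m → D.le m n → n = m
  trans : ∀ l n m, D.le l n → D.le n m → D.le l m
  mu_nonneg : ∀ n, 0 ≤ D.mu n
  nu_nonneg : ∀ n, 0 ≤ D.nu n
  mu_sum : HasSum D.mu 1
  nu_sum : HasSum D.nu 1
  dom : ∀ R : Set ℕ, UpwardClosed D.le R → ∑' n : R, D.mu n ≤ ∑' n : R, D.nu n

/-! ### Cuts and the greedy sequence -/

variable {D : InputData} {c c' : ℕ → ℝ} {F : Set (Finset ℕ × Finset ℕ)}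

theorem slack_zero (θ : Finset ℕ × Finset ℕ) :
    slack D c 0 θ = 1 - ∑ a ∈ θ.1, D.mu a - ∑ b ∈ θ.2, D.nu b := by
  simp [slack]

open Classical in
theorem slack_succ (i : ℕ) (θ : Finset ℕ × Finset ℕ) :
    slack D c (i + 1) θ = slack D c i θ - if Cross D i θ then c i else 0 := by
  simp only [slack, sum_range_succ]; ring

open Classical in
/-- The sequence that is greedy with respect to all pairs of finite sets. -/
noncomputable def greedy (D : InputData) (i : ℕ) : ℝ :=
  sInf {x | ∃ θ, Indep D θ ∧ Cross D i θ ∧ x = 1 - ∑ a ∈ θ.1, D.mu a - ∑ b ∈ θ.2, D.nu b -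
    ∑ j : Fin i, if Cross D j θ then greedy D j else 0}
termination_by i
decreasing_by exact j.2

theorem greedy_eq (i : ℕ) :
    greedy D i = sInf {x | ∃ θ, Indep D θ ∧ Cross D i θ ∧ x = slack D (greedy D) i θ} := by
  rw [greedy]
  simp only [slack, Finset.sum_range]

/-- With R the upper closure of A, μ(A) ≤ μ(R) ≤ ν(R), while independence puts B in the complement
of R. -/
theorem Admissible.gap_nonneg (h : Admissible D) {θ : Finset ℕ × Finset ℕ} (hθ : Indep D θ) :
    0 ≤ 1 - ∑ a ∈ θ.1, D.mu a - ∑ b ∈ θ.2, D.nu b := by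
  set R : Set ℕ := {x | ∃ a ∈ θ.1, D.le a x}
  have hR : UpwardClosed D.le R := fun n ⟨a, ha, han⟩ m hnm => ⟨a, ha, h.trans _ _ _ han hnm⟩
  have h1 := h.dom R hR
  rw [_root_.tsum_subtype, _root_.tsum_subtype] at h1
  have h2 : ∑ a ∈ θ.1, D.mu a ≤ ∑' n, R.indicator D.mu n := by
    refine le_trans (le_of_eq ?_) ((h.mu_sum.summable.indicator R).sum_le_tsum θ.1
      fun i _ => Set.indicator_nonneg (fun x _ => h.mu_nonneg x) i)
    exact Finset.sum_congr rfl fun a ha =>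
      (Set.indicator_of_mem (show a ∈ R from ⟨a, ha, h.refl a⟩) _).symm
  have h3 : ∑ b ∈ θ.2, D.nu b ≤ ∑' n, Rᶜ.indicator D.nu n := by
    refine le_trans (le_of_eq ?_) ((h.nu_sum.summable.indicator Rᶜ).sum_le_tsum θ.2
      fun i _ => Set.indicator_nonneg (fun x _ => h.nu_nonneg x) i)
    refine Finset.sum_congr rfl fun b hb => (Set.indicator_of_mem ?_ _).symm
    rintro ⟨a, ha, hab⟩
    exact hθ a ha b hb hab
  have h4 : ∑' n, R.indicator D.nu n + ∑' n, Rᶜ.indicator D.nu n = 1 := by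
    rw [← (h.nu_sum.summable.indicator R).tsum_add (h.nu_sum.summable.indicator Rᶜ),
      ← h.nu_sum.tsum_eq]
    exact tsum_congr fun n => Set.indicator_self_add_compl_apply R D.nu n
  linarith

theorem indep_empty : Indep D (∅, ∅) := fun a ha => by simp at ha

theorem Link.cross_empty {i : ℕ} (h : Link D i) : Cross D i (∅, ∅) := ⟨h, by simp, by simp⟩

/-- The amount subtracted at stage i is an infimum over all cuts crossing i, hence at most the slack
of each of them. Nonnegativity at stage i also supplies the lower bound that makes this real infimum
meaningful. -/
theorem Admissible.slack_greedy_nonneg (h : Admissible D) (i : ℕ) :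
    (∀ θ, Indep D θ → 0 ≤ slack D (greedy D) i θ) := by
  induction i with
  | zero => intro θ hθ; rw [slack_zero]; exact h.gap_nonneg hθ
  | succ i ih =>
    intro θ hθ
    rw [slack_succ]
    split_ifs with hc
    · rw [greedy_eq i, sub_nonneg]
      refine csInf_le ⟨0, ?_⟩ ⟨θ, hθ, hc, rfl⟩
      rintro x ⟨θ', hθ', -, rfl⟩
      exact ih θ' hθ'
    · simpa using ih θ hθ

theorem Admissible.isGreedy_greedy (h : Admissible D) : IsGreedy D Set.univ (greedy D) := by
  refine fun i => ⟨fun hi => ?_, fun hi => ?_⟩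
  · rw [greedy_eq i]
    simp only [Set.mem_univ, true_and]
    refine isGLB_csInf ⟨_, (∅, ∅), indep_empty, hi.cross_empty, rfl⟩ ⟨0, ?_⟩
    rintro x ⟨θ', hθ', -, rfl⟩
    exact h.slack_greedy_nonneg i θ' hθ'
  · rw [greedy_eq i]
    -- No cut is crossed by a pair that is not a link, and the infimum of the empty set of reals is
    -- 0.
    convert Real.sInf_empty
    ext x
    simp only [Set.mem_ofPred_eq, Set.mem_empty_iff_false, iff_false]
    rintro ⟨θ, -, hc, -⟩
    exact hi hc.1

theorem Admissible.greedy_nonneg (h : Admissible D) (i : ℕ) : 0 ≤ greedy D i := by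
  rw [greedy_eq]
  refine Real.sInf_nonneg ?_
  rintro x ⟨θ', hθ', -, rfl⟩
  exact h.slack_greedy_nonneg i θ' hθ'

-- A link cannot start in A and end in B when the cut is independent, so the indicator of crossing
-- is 1 minus the indicators of the two endpoint conditions. This makes the slack additive in A and
-- B and lets the limit be taken row by row and column by column.
open Classical in
theorem IsGreedy.slack_eq_of_indep (h : IsGreedy D F c) (i : ℕ) {θ : Finset ℕ × Finset ℕ}
    (hθ : Indep D θ) :
    slack D c i θ = 1 - ∑ j ∈ range i, c j
      - ∑ a ∈ θ.1, (D.mu a - ∑ j ∈ range i, if j.unpair.1 = a then c j else 0)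
      - ∑ b ∈ θ.2, (D.nu b - ∑ j ∈ range i, if j.unpair.2 = b then c j else 0) := by
  have key : ∀ j, (if Cross D j θ then c j else 0) = c j
      - (∑ a ∈ θ.1, if j.unpair.1 = a then c j else 0)
      - ∑ b ∈ θ.2, if j.unpair.2 = b then c j else 0 := by
    intro j
    rw [Finset.sum_ite_eq, Finset.sum_ite_eq]
    by_cases hj : Link D j
    · by_cases h1 : j.unpair.1 ∈ θ.1
      · have h2 : j.unpair.2 ∉ θ.2 := fun h2 => hθ _ h1 _ h2 hj.1
        simp [Cross, h1, h2]
      · by_cases h2 : j.unpair.2 ∈ θ.2 <;> simp [Cross, h1, h2, hj]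
    · simp [(h j).2 hj]
  rw [slack, Finset.sum_congr rfl fun j _ => key j]
  simp only [Finset.sum_sub_distrib]
  rw [Finset.sum_comm (s := range i) (t := θ.1), Finset.sum_comm (s := range i) (t := θ.2)]
  ring

/-! ### Row and column sums over coded positions -/

/-- The amount sent from `n`. -/
noncomputable def row (c : ℕ → ℝ) (n : ℕ) : ℝ := ∑' m, c (Nat.pair n m)

/-- The amount received by `m`. -/
noncomputable def col (c : ℕ → ℝ) (m : ℕ) : ℝ := ∑' n, c (Nat.pair n m)

theorem summable_pair (hc : Summable c) : Summable fun p : ℕ × ℕ => c (Nat.pair p.1 p.2) :=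
  (Nat.pairEquiv.summable_iff (f := c)).2 hc

theorem hasSum_row (hc : Summable c) (n : ℕ) : HasSum (fun m => c (Nat.pair n m)) (row c n) :=
  ((summable_pair hc).prod_factor n).hasSum

theorem hasSum_col (hc : Summable c) (m : ℕ) : HasSum (fun n => c (Nat.pair n m)) (col c m) :=
  ((summable_pair hc).prod_symm.prod_factor m).hasSum

theorem hasSum_ite_row (hc : Summable c) (n : ℕ) :
    HasSum (fun j => if j.unpair.1 = n then c j else 0) (row c n) := by
  have hinj : Function.Injective fun m => Nat.pair n m := fun x y hxy =>
    (Nat.pair_eq_pair.1 hxy).2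
  refine (hinj.hasSum_iff fun j hj => if_neg ?_).1 (by simpa [Function.comp_def] using hasSum_row hc n)
  rintro rfl
  exact hj ⟨j.unpair.2, Nat.pair_unpair j⟩

theorem hasSum_ite_col (hc : Summable c) (m : ℕ) :
    HasSum (fun j => if j.unpair.2 = m then c j else 0) (col c m) := by
  have hinj : Function.Injective fun n => Nat.pair n m := fun x y hxy =>
    (Nat.pair_eq_pair.1 hxy).1
  refine (hinj.hasSum_iff fun j hj => if_neg ?_).1 (by simpa [Function.comp_def] using hasSum_col hc m)
  rintro rfl
  exact hj ⟨j.unpair.1, Nat.pair_unpair j⟩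

theorem hasSum_rows (hc : Summable c) : HasSum (row c) (∑' j, c j) :=
  HasSum.prod_fiberwise ((Nat.pairEquiv.hasSum_iff (f := c)).2 hc.hasSum) (hasSum_row hc)

theorem hasSum_cols (hc : Summable c) : HasSum (col c) (∑' j, c j) :=
  HasSum.prod_fiberwise
    (((Equiv.prodComm ℕ ℕ).trans Nat.pairEquiv).hasSum_iff (f := c) |>.2 hc.hasSum) (hasSum_col hc)

theorem hasSum_ite_diag {g : ℕ → ℝ} {s : ℝ} (hg : HasSum g s) :
    HasSum (fun j : ℕ => if j.unpair.1 = j.unpair.2 then g j.unpair.1 else 0) s := by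
  have hinj : Function.Injective fun n => Nat.pair n n := fun x y hxy =>
    (Nat.pair_eq_pair.1 hxy).1
  refine (hinj.hasSum_iff fun j hj => if_neg ?_).1 (by simpa [Function.comp_def] using hg)
  intro h
  exact hj ⟨j.unpair.1, by conv_rhs => rw [← Nat.pair_unpair j, ← h]⟩

theorem Admissible.sum_greedy_le (h : Admissible D) (i : ℕ) : ∑ j ∈ range i, greedy D j ≤ 1 := by
  have h1 := h.slack_greedy_nonneg i (∅, ∅) indep_empty
  rw [h.isGreedy_greedy.slack_eq_of_indep i indep_empty] at h1
  simpa using h1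

theorem Admissible.summable_greedy (h : Admissible D) : Summable (greedy D) :=
  summable_of_sum_range_le h.greedy_nonneg h.sum_greedy_le

/-! ### Residual masses and almost tight cuts -/

/-- What remains at the sources. -/
noncomputable def muRes (D : InputData) (n : ℕ) : ℝ := D.mu n - row (greedy D) n

/-- What remains to be received. -/
noncomputable def nuRes (D : InputData) (n : ℕ) : ℝ := D.nu n - col (greedy D) n

/-- The slack that is left in the limit. -/
noncomputable def limSlack (D : InputData) (θ : Finset ℕ × Finset ℕ) : ℝ :=
  1 - ∑' j, greedy D j - ∑ a ∈ θ.1, muRes D a - ∑ b ∈ θ.2, nuRes D b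

theorem Admissible.tendsto_slack (h : Admissible D) {θ : Finset ℕ × Finset ℕ} (hθ : Indep D θ) :
    Tendsto (fun i => slack D (greedy D) i θ) atTop (𝓝 (limSlack D θ)) := by
  simp only [h.isGreedy_greedy.slack_eq_of_indep _ hθ, limSlack, muRes, nuRes]
  have hs := h.summable_greedy
  refine ((hs.hasSum.tendsto_sum_nat.const_sub 1).sub
    (tendsto_finsetSum _ fun a _ => ?_)).sub (tendsto_finsetSum _ fun b _ => ?_)
  · exact ((hasSum_ite_row hs a).tendsto_sum_nat).const_sub _
  · exact ((hasSum_ite_col hs b).tendsto_sum_nat).const_sub _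

theorem Admissible.antitone_slack (h : Admissible D) (θ : Finset ℕ × Finset ℕ) :
    Antitone fun i => slack D (greedy D) i θ := by
  refine antitone_nat_of_succ_le fun i => ?_
  rw [slack_succ]
  have := h.greedy_nonneg i
  split_ifs <;> linarith

theorem Admissible.limSlack_nonneg (h : Admissible D) {θ : Finset ℕ × Finset ℕ}
    (hθ : Indep D θ) : 0 ≤ limSlack D θ :=
  ge_of_tendsto' (h.tendsto_slack hθ) fun i => h.slack_greedy_nonneg i θ hθ

/-- A cut whose slack at stage j is within ε of the infimum has slack below ε once `greedy D j` is
subtracted, and slacks only decrease afterwards. -/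
theorem Admissible.exists_limSlack_le (h : Admissible D) {j : ℕ} (hj : Link D j) {ε : ℝ}
    (hε : 0 < ε) : ∃ θ, Indep D θ ∧ Cross D j θ ∧ limSlack D θ ≤ ε := by
  obtain ⟨x, ⟨θ, -, hθ, hc, rfl⟩, -, hx⟩ :=
    ((h.isGreedy_greedy j).1 hj).exists_between (show greedy D j < greedy D j + ε by linarith)
  refine ⟨θ, hθ, hc, ?_⟩
  have h1 := (h.antitone_slack θ).le_of_tendsto (h.tendsto_slack hθ) (j + 1)
  rw [slack_succ, if_pos hc] at h1
  linarith

theorem Admissible.hasSum_muRes (h : Admissible D) :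
    HasSum (muRes D) (1 - ∑' j, greedy D j) :=
  h.mu_sum.sub (hasSum_rows h.summable_greedy)

theorem Admissible.hasSum_nuRes (h : Admissible D) :
    HasSum (nuRes D) (1 - ∑' j, greedy D j) :=
  h.nu_sum.sub (hasSum_cols h.summable_greedy)

/-- Cuts with B empty are always independent. Letting A exhaust everything except n, their limiting
slack tends to the residue at n. -/
theorem Admissible.muRes_nonneg (h : Admissible D) (n : ℕ) : 0 ≤ muRes D n := by
  have h1 : ∀ i, 0 ≤ 1 - ∑' j, greedy D j - ∑ a ∈ range (n + 1 + i), muRes D a + muRes D n := by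
    intro i
    have h2 := h.limSlack_nonneg (θ := ((range (n + 1 + i)).erase n, ∅))
      fun a _ b hb => by simp at hb
    have h3 := sum_erase_add (range (n + 1 + i)) (muRes D) (a := n) (by simp; omega)
    simp only [limSlack, sum_empty] at h2
    linarith
  have h2 := ((h.hasSum_muRes.tendsto_sum_nat.comp
    (tendsto_add_atTop_nat (n + 1))).const_sub (1 - ∑' j, greedy D j)).add_const (muRes D n)
  rw [sub_self, zero_add] at h2
  exact ge_of_tendsto' h2 fun i => by simpa [add_comm] using h1 i

theorem Admissible.nuRes_nonneg (h : Admissible D) (n : ℕ) : 0 ≤ nuRes D n := by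
  have h1 : ∀ i, 0 ≤ 1 - ∑' j, greedy D j - ∑ a ∈ range (n + 1 + i), nuRes D a + nuRes D n := by
    intro i
    have h2 := h.limSlack_nonneg (θ := (∅, (range (n + 1 + i)).erase n))
      fun a ha => by simp at ha
    have h3 := sum_erase_add (range (n + 1 + i)) (nuRes D) (a := n) (by simp; omega)
    simp only [limSlack, sum_empty] at h2
    linarith
  have h2 := ((h.hasSum_nuRes.tendsto_sum_nat.comp
    (tendsto_add_atTop_nat (n + 1))).const_sub (1 - ∑' j, greedy D j)).add_const (nuRes D n)
  rw [sub_self, zero_add] at h2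
  exact ge_of_tendsto' h2 fun i => by simpa [add_comm] using h1 i

/-- Modularity, the identity behind uncrossing: if both combined cuts have nonnegative slack, each
is at most the sum of the original two. -/
theorem limSlack_inter_add_union (θ θ' : Finset ℕ × Finset ℕ) :
    limSlack D (θ.1 ∪ θ'.1, θ.2 ∩ θ'.2) + limSlack D (θ.1 ∩ θ'.1, θ.2 ∪ θ'.2)
      = limSlack D θ + limSlack D θ' := by
  have h1 := sum_union_inter (s₁ := θ.1) (s₂ := θ'.1) (f := muRes D)
  have h2 := sum_union_inter (s₁ := θ.2) (s₂ := θ'.2) (f := nuRes D)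
  simp only [limSlack]
  linarith

/-- Uncrossing: one almost tight pair of sets separates `n` from finitely many larger elements. -/
theorem Admissible.exists_limSlack_le_forall (h : Admissible D) (n M : ℕ) :
    ∀ ε : ℝ, 0 < ε → ∃ θ, Indep D θ ∧ n ∉ θ.1 ∧
      (∀ m < M, D.le n m → n ≠ m → m ∉ θ.2) ∧ limSlack D θ ≤ ε := by
  induction M with
  | zero =>
    intro ε hε
    -- With no element to avoid yet, A is empty and B is an initial segment holding all but ε of the
    -- residual target mass.
    obtain ⟨K, hK⟩ := (h.hasSum_nuRes.tendsto_sum_nat.eventually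
      (lt_mem_nhds (show 1 - ∑' j, greedy D j - ε < _ by linarith))).exists
    refine ⟨(∅, range K), fun a ha => by simp at ha, by simp, by simp, ?_⟩
    simp only [limSlack, sum_empty]
    linarith
  | succ M ih =>
    intro ε hε
    by_cases hM : D.le n M ∧ n ≠ M
    · obtain ⟨θ, h1, h2, h3, h4⟩ := ih (ε / 2) (by positivity)
      obtain ⟨θ', h1', h2', h4'⟩ := h.exists_limSlack_le (j := Nat.pair n M)
        (by simpa [Link] using hM) (half_pos hε)
      simp only [Cross, Nat.unpair_pair] at h2'
      -- The opposite combination is also a cut, so its slack is nonnegative and the cut used below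
      -- inherits at most ε / 2 + ε / 2.
      have hi : Indep D (θ.1 ∩ θ'.1, θ.2 ∪ θ'.2) := by
        intro a ha b hb
        simp only [mem_inter, mem_union] at ha hb
        exact hb.elim (h1 a ha.1 b) (h1' a ha.2 b)
      refine ⟨(θ.1 ∪ θ'.1, θ.2 ∩ θ'.2), ?_, ?_, ?_, ?_⟩
      · intro a ha b hb
        simp only [mem_inter, mem_union] at ha hb
        exact ha.elim (fun ha => h1 a ha b hb.1) (fun ha => h1' a ha b hb.2)
      · simp [h2, h2'.2.1]
      · intro m hm hnm hne
        rcases Nat.lt_succ_iff_lt_or_eq.1 hm with hm | rfl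
        · simp [h3 m hm hnm hne]
        · simp [h2'.2.2]
      · have := h.limSlack_nonneg hi
        have := limSlack_inter_add_union (D := D) θ θ'
        linarith
    · obtain ⟨θ, h1, h2, h3, h4⟩ := ih ε hε
      refine ⟨θ, h1, h2, fun m hm hnm hne => ?_, h4⟩
      rcases Nat.lt_succ_iff_lt_or_eq.1 hm with hm | rfl
      · exact h3 m hm hnm hne
      · exact absurd ⟨hnm, hne⟩ hM

-- Take an almost tight cut separating n from the elements strictly above it and below M. Adding n
-- to A and removing from B all elements above n gives another cut, so the residue at n is at most
-- the slack plus the residual target mass removed. Apart from n itself, only elements from M on are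
-- removed, and these carry little mass.
open Classical in
theorem Admissible.muRes_le_nuRes (h : Admissible D) (n : ℕ) : muRes D n ≤ nuRes D n := by
  refine le_of_forall_pos_le_add fun ε hε => ?_
  obtain ⟨M, hM⟩ := (h.hasSum_nuRes.tendsto_sum_nat.eventually
      (lt_mem_nhds (show 1 - ∑' j, greedy D j - ε / 2 < _ by linarith))).exists
  obtain ⟨θ, h1, h2, h3, h4⟩ := h.exists_limSlack_le_forall n M (ε / 2) (half_pos hε)
  have h5 := h.limSlack_nonneg (θ := (insert n θ.1, θ.2.filter fun b => ¬ D.le n b)) (by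
    intro a ha b hb
    simp only [mem_insert, mem_filter] at ha hb
    rcases ha with rfl | ha
    · exact hb.2
    · exact h1 a ha b hb.1)
  simp only [limSlack, sum_insert h2] at h4 h5
  have h6 := sum_filter_add_sum_filter_not θ.2 (fun b => D.le n b) (nuRes D)
  have h7 : ∑ b ∈ θ.2 with D.le n b, nuRes D b ≤
      nuRes D n + ∑ b ∈ θ.2.filter (fun b => M ≤ b), nuRes D b := by
    have hsub : θ.2.filter (fun b => D.le n b) ⊆ {n} ∪ θ.2.filter (fun b => M ≤ b) := by
      intro b hb
      simp only [mem_filter, mem_union, mem_singleton] at hb ⊢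
      by_cases hbn : b = n
      · exact Or.inl hbn
      · refine Or.inr ⟨hb.1, not_lt.1 fun hlt => h3 b hlt hb.2 (Ne.symm hbn) hb.1⟩
    have h8 := sum_union_inter (s₁ := {n}) (s₂ := θ.2.filter (fun b => M ≤ b)) (f := nuRes D)
    have h9 : 0 ≤ ∑ b ∈ {n} ∩ θ.2.filter (fun b => M ≤ b), nuRes D b :=
      sum_nonneg fun b _ => h.nuRes_nonneg b
    have := sum_le_sum_of_subset_of_nonneg hsub fun b _ _ => h.nuRes_nonneg b
    rw [sum_singleton] at h8
    linarith
  have h8 : ∑ b ∈ range M, nuRes D b + ∑ b ∈ θ.2.filter (fun b => M ≤ b), nuRes D b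
      ≤ 1 - ∑' j, greedy D j := by
    rw [← sum_union]
    · exact sum_le_hasSum _ (fun b _ => h.nuRes_nonneg b) h.hasSum_nuRes
    · rw [Finset.disjoint_left]
      intro b hb hb'
      simp only [mem_range, mem_filter] at hb hb'
      omega
  linarith

/-- The nonnegative differences sum to 0, since both residues have the same total. -/
theorem Admissible.muRes_eq_nuRes (h : Admissible D) (n : ℕ) : muRes D n = nuRes D n := by
  have h1 := h.hasSum_nuRes.sub h.hasSum_muRes
  rw [sub_self, hasSum_zero_iff_of_nonneg fun n => sub_nonneg.2 (h.muRes_le_nuRes n)] at h1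
  exact (sub_eq_zero.1 (congrFun h1 n)).symm

/-! ### Truncation to finitely many cuts -/

/-- The part of both sequences outside the first `N` terms. -/
noncomputable def tailMass (D : InputData) (N : ℕ) : ℝ :=
  2 - ∑ n ∈ range N, (D.mu n + D.nu n)

theorem Admissible.sum_le_sum_filter_add {f : ℕ → ℝ} (h0 : ∀ n, 0 ≤ f n) (h1 : HasSum f 1)
    (A : Finset ℕ) (N : ℕ) :
    ∑ a ∈ A, f a ≤ ∑ a ∈ A.filter (· < N), f a + (1 - ∑ a ∈ range N, f a) := by
  have h2 := sum_filter_add_sum_filter_not A (· < N) f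
  have h3 : ∑ b ∈ range N, f b + ∑ b ∈ A.filter (fun b => ¬ b < N), f b ≤ 1 := by
    rw [← sum_union]
    · exact sum_le_hasSum _ (fun b _ => h0 b) h1
    · rw [Finset.disjoint_left]
      intro b hb hb'
      simp only [mem_range, mem_filter] at hb hb'
      exact hb'.2 hb
  linarith

theorem Admissible.tailMass_nonneg (h : Admissible D) (N : ℕ) : 0 ≤ tailMass D N := by
  have h1 := sum_le_hasSum (range N) (fun b _ => h.mu_nonneg b) h.mu_sum
  have h2 := sum_le_hasSum (range N) (fun b _ => h.nu_nonneg b) h.nu_sum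
  rw [tailMass, sum_add_distrib]
  linarith

theorem Admissible.tendsto_tailMass (h : Admissible D) : Tendsto (tailMass D) atTop (𝓝 0) := by
  have := ((h.mu_sum.add h.nu_sum).tendsto_sum_nat).const_sub 2
  norm_num at this
  exact this

/-- The pairs of subsets of the first `N` natural numbers. -/
def cutsBelow (N : ℕ) : Set (Finset ℕ × Finset ℕ) :=
  {θ | (∀ a ∈ θ.1, a < N) ∧ ∀ b ∈ θ.2, b < N}

open Classical in
theorem abs_slack_sub_le {e : ℕ → ℝ} (i : ℕ) (he : ∀ j < i, |c' j - c j| ≤ e j)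
    (θ : Finset ℕ × Finset ℕ) :
    |slack D c' i θ - slack D c i θ| ≤ ∑ j ∈ range i, e j := by
  have : slack D c' i θ - slack D c i θ
      = -∑ j ∈ range i, if Cross D j θ then c' j - c j else 0 := by
    rw [slack, slack, sub_sub_sub_cancel_left, ← sum_sub_distrib, ← sum_neg_distrib]
    refine sum_congr rfl fun j _ => ?_
    split_ifs <;> simp
  rw [this, abs_neg]
  refine (abs_sum_le_sum_abs _ _).trans (sum_le_sum fun j hj => ?_)
  have := he j (mem_range.1 hj)
  split_ifs
  · exact this
  · simpa using (abs_nonneg _).trans this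

-- The errors obey e_i ≤ T + ∑_{j<i} e_j with T the tail mass, which gives e_i ≤ 2^i T. The sum is
-- the effect of earlier errors on a slack; T is the cost of replacing a cut by its part below N.
open Classical in
theorem Admissible.abs_sub_greedy_le (h : Admissible D) {N : ℕ}
    (hc : IsGreedy D (cutsBelow N) c) (i : ℕ) (hi : i < N) :
    |c i - greedy D i| ≤ 2 ^ i * tailMass D N := by
  induction i using Nat.strong_induction_on with
  | _ i ih =>
  have ht := h.tailMass_nonneg N
  by_cases hL : Link D i
  swap
  · rw [(hc i).2 hL, (h.isGreedy_greedy i).2 hL]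
    simpa using ht
  have hsl := abs_slack_sub_le (D := D) (c := greedy D) (c' := c) (e := fun j => 2 ^ j * tailMass D N)
    i (fun j hj => ih j hj (hj.trans hi))
  have hgeom : ∑ j ∈ range i, 2 ^ j * tailMass D N = (2 ^ i - 1) * tailMass D N := by
    rw [← sum_mul, geom_sum_eq (by norm_num)]; norm_num
  rw [hgeom] at hsl
  rw [abs_le]
  constructor
  -- Cuts below N also compete in the full infimum, so this direction loses only the inherited
  -- error.
  · suffices greedy D i - 2 ^ i * tailMass D N ≤ c i by linarith
    refine (le_isGLB_iff ((hc i).1 hL)).2 ?_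
    rintro x ⟨θ, -, hθ, hx, rfl⟩
    have h1 := ((h.isGreedy_greedy i).1 hL).1 ⟨θ, trivial, hθ, hx, rfl⟩
    have h2 := (abs_le.1 (hsl θ)).1
    linarith
  · rw [sub_le_comm]
    refine (le_isGLB_iff ((h.isGreedy_greedy i).1 hL)).2 ?_
    rintro x ⟨θ, -, hθ, hx, rfl⟩
    set θ' : Finset ℕ × Finset ℕ := (θ.1.filter (· < N), θ.2.filter (· < N)) with hθ'
    -- Both components of a code j are at most j, hence below N: truncating the cut does not change
    -- which pairs j < N cross it.
    have hmem : ∀ j < N, (j.unpair.1 ∈ θ'.1 ↔ j.unpair.1 ∈ θ.1) ∧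
        (j.unpair.2 ∈ θ'.2 ↔ j.unpair.2 ∈ θ.2) := by
      intro j hj
      simp [hθ', (Nat.unpair_left_le j).trans_lt hj, (Nat.unpair_right_le j).trans_lt hj]
    have hcr : ∀ j < N, (Cross D j θ' ↔ Cross D j θ) := fun j hj => by
      rw [Cross, Cross, (hmem j hj).1, (hmem j hj).2]
    have h1 := ((hc i).1 hL).1 ⟨θ', ⟨fun a ha => (mem_filter.1 ha).2,
      fun b hb => (mem_filter.1 hb).2⟩,
      fun a ha b hb => hθ a (mem_filter.1 ha).1 b (mem_filter.1 hb).1, (hcr i hi).2 hx, rfl⟩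
    have h2 := (abs_le.1 (hsl θ')).2
    have h3 : slack D (greedy D) i θ' ≤ slack D (greedy D) i θ + tailMass D N := by
      have h4 := sum_le_sum_filter_add h.mu_nonneg h.mu_sum θ.1 N
      have h5 := sum_le_sum_filter_add h.nu_nonneg h.nu_sum θ.2 N
      have h6 : ∑ j ∈ range i, (if Cross D j θ' then greedy D j else 0)
          = ∑ j ∈ range i, if Cross D j θ then greedy D j else 0 :=
        sum_congr rfl fun j hj => by simp only [hcr j ((mem_range.1 hj).trans hi)]
      rw [slack, slack, h6, tailMass, sum_add_distrib]
      simp only [hθ']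
      linarith
    linarith

/-! ### Closure properties of computable functions -/

/-- `f` is computed by a program that halts for all admissible data and all inputs. -/
def Comp {a b : Ty} (f : InputData → a.Val → b.Val) : Prop :=
  ∃ p : Prog a b, ∀ D, Admissible D → ∀ x, ∃ t, Run D p x (f D x) t

open Classical in
/-- The property `p` is decided by a program. -/
def Dec {a : Ty} (p : InputData → a.Val → Prop) : Prop :=
  Comp (b := .nat) fun D x => if p D x then (1 : ℕ) else (0 : ℕ)

section closure

variable {a b s : Ty}

theorem Comp.of_op (o : Op a b) {f : InputData → a.Val → b.Val}
    (h : ∀ D x, o.eval D x = some (f D x)) : Comp f :=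
  ⟨.op o, fun D _ x => ⟨1, .op (h D x)⟩⟩

theorem Comp.comp {g : InputData → b.Val → s.Val} {f : InputData → a.Val → b.Val}
    (hg : Comp g) (hf : Comp f) : Comp fun D x => g D (f D x) := by
  obtain ⟨p, hp⟩ := hf
  obtain ⟨q, hq⟩ := hg
  refine ⟨.seq p q, fun D hD x => ?_⟩
  obtain ⟨t, ht⟩ := hp D hD x
  obtain ⟨u, hu⟩ := hq D hD (f D x)
  exact ⟨_, .seq ht hu⟩

theorem Comp.pair {f : InputData → a.Val → b.Val} {g : InputData → a.Val → s.Val}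
    (hf : Comp f) (hg : Comp g) : Comp (b := .prod b s) fun D x => (f D x, g D x) := by
  obtain ⟨p, hp⟩ := hf
  obtain ⟨q, hq⟩ := hg
  refine ⟨.pair p q, fun D hD x => ?_⟩
  obtain ⟨t, ht⟩ := hp D hD x
  obtain ⟨u, hu⟩ := hq D hD x
  exact ⟨_, .pair ht hu⟩

theorem Comp.id : Comp (a := a) (b := a) fun _ x => x := .of_op .id fun _ _ => rfl

theorem Comp.fst {f : InputData → a.Val → b.Val × s.Val} (hf : Comp (b := .prod b s) f) :
    Comp fun D x => (f D x).1 :=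
  (Comp.of_op (Op.fst (a := b) (b := s)) (f := fun _ y => y.1) fun _ _ => rfl).comp hf

theorem Comp.snd {f : InputData → a.Val → b.Val × s.Val} (hf : Comp (b := .prod b s) f) :
    Comp fun D x => (f D x).2 :=
  (Comp.of_op (Op.snd (a := b) (b := s)) (f := fun _ y => y.2) fun _ _ => rfl).comp hf

theorem Comp.rzero : Comp (a := a) (b := .real) fun _ _ => (0 : ℝ) := .of_op .rzero fun _ _ => rfl

theorem Comp.rone : Comp (a := a) (b := .real) fun _ _ => (1 : ℝ) := .of_op .rone fun _ _ => rfl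

theorem Comp.radd {f g : InputData → a.Val → ℝ} (hf : Comp (b := .real) f)
    (hg : Comp (b := .real) g) : Comp (b := .real) fun D x => f D x + g D x :=
  (Comp.of_op .radd (f := fun _ y => (y.1 + y.2 : ℝ)) fun _ _ => rfl).comp (hf.pair hg)

theorem Comp.rsub {f g : InputData → a.Val → ℝ} (hf : Comp (b := .real) f)
    (hg : Comp (b := .real) g) : Comp (b := .real) fun D x => f D x - g D x :=
  (Comp.of_op .rsub (f := fun _ y => (y.1 - y.2 : ℝ)) fun _ _ => rfl).comp (hf.pair hg)

theorem Comp.rmul {f g : InputData → a.Val → ℝ} (hf : Comp (b := .real) f)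
    (hg : Comp (b := .real) g) : Comp (b := .real) fun D x => f D x * g D x :=
  (Comp.of_op .rmul (f := fun _ y => (y.1 * y.2 : ℝ)) fun _ _ => rfl).comp (hf.pair hg)

theorem Comp.mu {f : InputData → a.Val → ℕ} (hf : Comp (b := .nat) f) :
    Comp (b := .real) fun D x => D.mu (f D x) :=
  (Comp.of_op .mu (f := fun D (y : ℕ) => D.mu y) fun _ _ => rfl).comp hf

theorem Comp.nu {f : InputData → a.Val → ℕ} (hf : Comp (b := .nat) f) :
    Comp (b := .real) fun D x => D.nu (f D x) :=
  (Comp.of_op .nu (f := fun D (y : ℕ) => D.nu y) fun _ _ => rfl).comp hf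

theorem Comp.succ {f : InputData → a.Val → ℕ} (hf : Comp (b := .nat) f) :
    Comp (b := .nat) fun D x => f D x + 1 :=
  (Comp.of_op .nsucc (f := fun _ (y : ℕ) => (y + 1 : ℕ)) fun _ _ => rfl).comp hf

theorem Comp.nconst (n : ℕ) : Comp (a := a) (b := .nat) fun _ _ => n := by
  induction n with
  | zero => exact .of_op .nzero fun _ _ => rfl
  | succ n ih => exact ih.succ

theorem Comp.nadd {f g : InputData → a.Val → ℕ} (hf : Comp (b := .nat) f)
    (hg : Comp (b := .nat) g) : Comp (b := .nat) fun D x => f D x + g D x :=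
  (Comp.of_op .nadd (f := fun _ y => (y.1 + y.2 : ℕ)) fun _ _ => rfl).comp (hf.pair hg)

theorem Comp.nsub {f g : InputData → a.Val → ℕ} (hf : Comp (b := .nat) f)
    (hg : Comp (b := .nat) g) : Comp (b := .nat) fun D x => f D x - g D x :=
  (Comp.of_op .nmonus (f := fun _ y => (y.1 - y.2 : ℕ)) fun _ _ => rfl).comp (hf.pair hg)

theorem Comp.nmul {f g : InputData → a.Val → ℕ} (hf : Comp (b := .nat) f)
    (hg : Comp (b := .nat) g) : Comp (b := .nat) fun D x => f D x * g D x :=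
  (Comp.of_op .nmul (f := fun _ y => (y.1 * y.2 : ℕ)) fun _ _ => rfl).comp (hf.pair hg)

theorem Comp.nil : Comp (a := a) (b := .list s) fun _ _ => [] := .of_op .nil fun _ _ => rfl

theorem Comp.cons {f : InputData → a.Val → s.Val} {g : InputData → a.Val → List s.Val}
    (hf : Comp f) (hg : Comp (b := .list s) g) :
    Comp (b := .list s) fun D x => f D x :: g D x :=
  (Comp.of_op .cons (f := fun _ y => y.1 :: y.2) fun _ _ => rfl).comp (hf.pair hg)

theorem Dec.exists_prog {p : InputData → a.Val → Prop} (hp : Dec p) :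
    ∃ r : Prog a .nat, ∀ D, Admissible D → ∀ x,
      (p D x → ∃ t, Run D r x (1 : ℕ) t) ∧ (¬ p D x → ∃ t, Run D r x (0 : ℕ) t) := by
  obtain ⟨r, hr⟩ := hp
  refine ⟨r, fun D hD x => ?_⟩
  have ht := hr D hD x
  beta_reduce at ht
  exact ⟨fun h => by rwa [if_pos h] at ht, fun h => by rwa [if_neg h] at ht⟩

theorem Dec.of_prog {p : InputData → a.Val → Prop} {r : Prog a .nat}
    (h1 : ∀ D, Admissible D → ∀ x, p D x → ∃ t, Run D r x (1 : ℕ) t)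
    (h0 : ∀ D, Admissible D → ∀ x, ¬ p D x → ∃ t, Run D r x (0 : ℕ) t) : Dec p := by
  refine ⟨r, fun D hD x => ?_⟩
  beta_reduce
  split_ifs with h
  · exact h1 D hD x h
  · exact h0 D hD x h

theorem Dec.ite {p : InputData → a.Val → Prop} [∀ D x, Decidable (p D x)]
    {f g : InputData → a.Val → b.Val} (hp : Dec p) (hf : Comp f) (hg : Comp g) :
    Comp fun D x => if p D x then f D x else g D x := by
  obtain ⟨r, hr⟩ := hp.exists_prog
  obtain ⟨P, hP⟩ := hf
  obtain ⟨Q, hQ⟩ := hg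
  refine ⟨.ite r P Q, fun D hD x => ?_⟩
  beta_reduce
  by_cases h : p D x
  · obtain ⟨u, hu⟩ := hP D hD x
    obtain ⟨t, ht⟩ := (hr D hD x).1 h
    rw [if_pos h]
    exact ⟨_, .ite_true ht one_ne_zero hu⟩
  · obtain ⟨u, hu⟩ := hQ D hD x
    obtain ⟨t, ht⟩ := (hr D hD x).2 h
    rw [if_neg h]
    exact ⟨_, .ite_false ht rfl hu⟩

theorem Dec.congr {p q : InputData → a.Val → Prop} (hp : Dec p) (h : ∀ D x, q D x ↔ p D x) :
    Dec q := by
  have : q = p := funext fun D => funext fun x => propext (h D x)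
  rwa [this]

theorem Dec.comp {p : InputData → b.Val → Prop} {f : InputData → a.Val → b.Val} (hp : Dec p)
    (hf : Comp f) : Dec fun D x => p D (f D x) :=
  Comp.comp hp hf

theorem Dec.not {p : InputData → a.Val → Prop} (hp : Dec p) : Dec fun D x => ¬ p D x := by
  classical
  have h := hp.ite (Comp.nconst 0) (Comp.nconst 1)
  unfold Dec
  convert h using 3 with D x
  by_cases hx : p D x <;> simp [hx]

theorem Dec.and {p q : InputData → a.Val → Prop} (hp : Dec p) (hq : Dec q) :
    Dec fun D x => p D x ∧ q D x := by
  classical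
  have h := hp.ite hq (Comp.nconst 0)
  unfold Dec
  convert h using 3 with D x
  by_cases hx : p D x <;> simp [hx]

theorem Dec.or {p q : InputData → a.Val → Prop} (hp : Dec p) (hq : Dec q) :
    Dec fun D x => p D x ∨ q D x :=
  (hp.not.and hq.not).not.congr fun _ _ => by tauto

theorem Dec.imp {p q : InputData → a.Val → Prop} (hp : Dec p) (hq : Dec q) :
    Dec fun D x => p D x → q D x :=
  (hp.not.or hq).congr fun _ _ => by tauto

theorem Dec.ord {f g : InputData → a.Val → ℕ} (hf : Comp (b := .nat) f)
    (hg : Comp (b := .nat) g) : Dec fun D x => D.le (f D x) (g D x) := by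
  classical
  exact (Comp.of_op .ord (f := fun D y => if D.le y.1 y.2 then (1 : ℕ) else (0 : ℕ))
    fun D x => by simp only [Op.eval]).comp (hf.pair hg)

theorem Dec.rle {f g : InputData → a.Val → ℝ} (hf : Comp (b := .real) f)
    (hg : Comp (b := .real) g) : Dec fun D x => f D x ≤ g D x := by
  classical
  exact (Comp.of_op .rle (f := fun D y => if (y.1 : ℝ) ≤ y.2 then (1 : ℕ) else (0 : ℕ))
    fun D x => by simp only [Op.eval]).comp (hf.pair hg)

theorem Dec.nle {f g : InputData → a.Val → ℕ} (hf : Comp (b := .nat) f)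
    (hg : Comp (b := .nat) g) : Dec fun D x => f D x ≤ g D x := by
  obtain ⟨p, hp⟩ := hf.nsub hg
  obtain ⟨P, hP⟩ := Comp.nconst (a := a) 0
  obtain ⟨Q, hQ⟩ := Comp.nconst (a := a) 1
  refine Dec.of_prog (r := .ite p P Q) (fun D hD x h => ?_) (fun D hD x h => ?_)
  · obtain ⟨t, ht⟩ := hp D hD x
    obtain ⟨u, hu⟩ := hQ D hD x
    exact ⟨_, .ite_false ht (Nat.sub_eq_zero_of_le h) hu⟩
  · obtain ⟨t, ht⟩ := hp D hD x
    obtain ⟨u, hu⟩ := hP D hD x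
    exact ⟨_, .ite_true ht (Nat.sub_ne_zero_of_lt (not_le.1 h)) hu⟩

theorem Dec.nlt {f g : InputData → a.Val → ℕ} (hf : Comp (b := .nat) f)
    (hg : Comp (b := .nat) g) : Dec fun D x => f D x < g D x :=
  Dec.nle hf.succ hg

theorem Dec.neq {f g : InputData → a.Val → ℕ} (hf : Comp (b := .nat) f)
    (hg : Comp (b := .nat) g) : Dec fun D x => f D x = g D x :=
  ((Dec.nle hf hg).and (Dec.nle hg hf)).congr fun _ _ => le_antisymm_iff

theorem Comp.getD {l : InputData → a.Val → List ℝ} {n : InputData → a.Val → ℕ}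
    (hl : Comp (b := .list .real) l) (hn : Comp (b := .nat) n) :
    Comp (b := .real) fun D x => (l D x).getD (n D x) 0 := by
  have hlen : Comp (b := .nat) fun D x => (l D x).length :=
    (Comp.of_op (.length (a := .real)) (f := fun _ y => List.length y) fun _ _ => rfl).comp hl
  obtain ⟨r, hr⟩ := (Dec.nlt hn hlen).exists_prog
  obtain ⟨P, hP⟩ := hl.pair hn
  obtain ⟨Q, hQ⟩ := Comp.rzero (a := a)
  refine ⟨.ite r (.seq P (.op .get)) Q, fun D hD x => ?_⟩
  by_cases h : n D x < (l D x).length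
  · obtain ⟨u, hu⟩ := hP D hD x
    obtain ⟨t, ht⟩ := (hr D hD x).1 h
    refine ⟨_, .ite_true ht one_ne_zero (.seq hu (.op ?_))⟩
    simp [Op.eval, h]
  · obtain ⟨u, hu⟩ := hQ D hD x
    obtain ⟨t, ht⟩ := (hr D hD x).2 h
    beta_reduce
    rw [List.getD_eq_default _ _ (not_lt.1 h)]
    exact ⟨_, .ite_false ht rfl hu⟩

theorem Run.while_of_iterate {D : InputData} {r : Prog a .nat} {p : Prog a a} {n : ℕ}
    {st : ℕ → a.Val} (hstep : ∀ j < n, ∃ v t u, v ≠ 0 ∧ Run D r (st j) v t ∧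
      Run D p (st j) (st (j + 1)) u) (h_last : ∃ t, Run D r (st n) (0 : ℕ) t) :
    ∃ t, Run D (.while r p) (st 0) (st n) t := by
  induction n generalizing st with
  | zero =>
    obtain ⟨t, ht⟩ := h_last
    exact ⟨t, by constructor <;> first | exact ht | rfl⟩
  | succ n ih =>
    obtain ⟨v, t, u, hv, h1, h2⟩ := hstep 0 (Nat.succ_pos n)
    obtain ⟨w, hw⟩ := ih (st := fun j => st (j + 1))
      (fun j hj => hstep (j + 1) (Nat.succ_lt_succ hj)) h_last
    exact ⟨_, .while_step h1 hv h2 hw⟩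

/-- The loop carries the input, a counter and the accumulator; the truncated difference between the
bound and the counter is its test, zero exactly when the counter has reached the bound. -/
theorem Comp.natRec {f : InputData → a.Val → b.Val} {g : InputData → a.Val → ℕ → b.Val → b.Val}
    {n : InputData → a.Val → ℕ} (hf : Comp f)
    (hg : Comp (a := .prod a (.prod .nat b)) fun D y => g D y.1 y.2.1 y.2.2)
    (hn : Comp (b := .nat) n) :
    Comp fun D x => (Nat.rec (f D x) (g D x) (n D x) : b.Val) := by
  have hid := Comp.id (a := .prod a (.prod .nat b))
  obtain ⟨P, hP⟩ := (Comp.id (a := a)).pair ((Comp.nconst (a := a) 0).pair hf)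
  obtain ⟨r, hr⟩ := (hn.comp hid.fst).nsub hid.snd.fst
  obtain ⟨p, hp⟩ := hid.fst.pair (hid.snd.fst.succ.pair hg)
  obtain ⟨Q, hQ⟩ := hid.snd.snd
  refine ⟨.seq P (.seq (.while r p) Q), fun D hD x => ?_⟩
  obtain ⟨t, ht⟩ := hP D hD x
  set st : ℕ → a.Val × ℕ × b.Val := fun j => (x, j, Nat.rec (f D x) (g D x) j)
  obtain ⟨u, hu⟩ := Run.while_of_iterate (a := .prod a (.prod .nat b)) (D := D) (r := r) (p := p)
    (n := n D x) (st := st) (fun j hj => by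
      obtain ⟨t, ht⟩ := hr D hD (st j)
      obtain ⟨u, hu⟩ := hp D hD (st j)
      exact ⟨_, t, u, Nat.sub_ne_zero_of_lt hj, ht, hu⟩) (by
      obtain ⟨t, ht⟩ := hr D hD (st (n D x))
      exact ⟨t, by simpa [st] using ht⟩)
  obtain ⟨v, hv⟩ := hQ D hD (st (n D x))
  exact ⟨_, .seq ht (.seq hu hv)⟩

/-- Unbounded search. It halts because a witness exists for all admissible data, which is why `Comp`
asks for halting only on these. -/
theorem Comp.find {p : InputData → a.Val → ℕ → Prop}
    (hp : Dec (a := .prod a .nat) fun D y => p D y.1 y.2)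
    (h : ∀ D, Admissible D → ∀ x, ∃ n, p D x n) :
    Comp (b := .nat) fun D x => sInf {n | p D x n} := by
  have hid := Comp.id (a := .prod a .nat)
  obtain ⟨P, hP⟩ := (Comp.id (a := a)).pair (Comp.nconst (a := a) 0)
  obtain ⟨r, hr⟩ := hp.not.exists_prog
  obtain ⟨q, hq⟩ := hid.fst.pair hid.snd.succ
  obtain ⟨Q, hQ⟩ := hid.snd
  refine ⟨.seq P (.seq (.while r q) Q), fun D hD x => ?_⟩
  obtain ⟨t, ht⟩ := hP D hD x
  set st : ℕ → a.Val × ℕ := fun j => (x, j)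
  obtain ⟨u, hu⟩ := Run.while_of_iterate (a := .prod a .nat) (D := D) (r := r) (p := q)
    (n := sInf {n | p D x n}) (st := st) (fun j hj => by
      obtain ⟨t, ht⟩ := (hr D hD (st j)).1 (Nat.notMem_of_lt_sInf hj)
      obtain ⟨u, hu⟩ := hq D hD (st j)
      exact ⟨_, t, u, one_ne_zero, ht, hu⟩)
    ((hr D hD _).2 (not_not.2 (Nat.sInf_mem (h D hD x))))
  obtain ⟨v, hv⟩ := hQ D hD (st (sInf {n | p D x n}))
  exact ⟨_, .seq ht (.seq hu hv)⟩

theorem Comp.sum_range {f : InputData → a.Val → ℕ → ℝ} {n : InputData → a.Val → ℕ}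
    (hf : Comp (a := .prod a .nat) (b := .real) fun D y => f D y.1 y.2) (hn : Comp (b := .nat) n) :
    Comp (b := .real) fun D x => ∑ i ∈ range (n D x), f D x i := by
  have hid := Comp.id (a := .prod a (.prod .nat .real))
  have h := Comp.natRec (b := .real) (g := fun D x i (acc : ℝ) => acc + f D x i) (Comp.rzero (a := a))
    (hid.snd.snd.radd (hf.comp (hid.fst.pair hid.snd.fst))) hn
  convert h using 3 with D x
  induction n D x with
  | zero => simp
  | succ k ih => rw [Finset.sum_range_succ, ih]

theorem Dec.ball {p : InputData → a.Val → ℕ → Prop} {n : InputData → a.Val → ℕ}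
    (hp : Dec (a := .prod a .nat) fun D y => p D y.1 y.2) (hn : Comp (b := .nat) n) :
    Dec fun D x => ∀ i < n D x, p D x i := by
  classical
  have hid := Comp.id (a := .prod a (.prod .nat .nat))
  have h := Comp.natRec (b := .nat) (g := fun D x i (acc : ℕ) => if p D x i then acc else (0 : ℕ))
    (Comp.nconst (a := a) 1)
    (Dec.ite (b := .nat) (hp.comp (hid.fst.pair hid.snd.fst)) hid.snd.snd (Comp.nconst 0)) hn
  unfold Dec
  convert h using 3 with D x
  beta_reduce
  induction n D x with
  | zero => simp
  | succ k ih =>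
    simp only [← ih, Nat.forall_lt_succ_right]
    by_cases hk : p D x k <;> simp [hk]

theorem Dec.bex {p : InputData → a.Val → ℕ → Prop} {n : InputData → a.Val → ℕ}
    (hp : Dec (a := .prod a .nat) fun D y => p D y.1 y.2) (hn : Comp (b := .nat) n) :
    Dec fun D x => ∃ i < n D x, p D x i :=
  (Dec.ball (p := fun D x i => ¬ p D x i) hp.not hn).not.congr fun _ _ => by push Not; rfl

theorem Comp.two_pow {n : InputData → a.Val → ℕ} (hn : Comp (b := .nat) n) :
    Comp (b := .nat) fun D x => 2 ^ n D x := by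
  have hid := Comp.id (a := .prod a (.prod .nat .nat))
  have h := Comp.natRec (b := .nat) (g := fun _ _ _ (acc : ℕ) => acc * 2)
    (Comp.nconst (a := a) 1) (hid.snd.snd.nmul (Comp.nconst 2)) hn
  convert h using 3 with D x
  induction n D x with
  | zero => simp
  | succ k ih => rw [pow_succ, ih]

theorem Comp.rtwo_pow {n : InputData → a.Val → ℕ} (hn : Comp (b := .nat) n) :
    Comp (b := .real) fun D x => (2 : ℝ) ^ n D x := by
  have hid := Comp.id (a := .prod a (.prod .nat .real))
  have h := Comp.natRec (b := .real) (g := fun _ _ _ (acc : ℝ) => acc + acc)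
    (Comp.rone (a := a)) (hid.snd.snd.radd hid.snd.snd) hn
  convert h using 3 with D x
  induction n D x with
  | zero => simp
  | succ k ih => rw [pow_succ, ih]; ring

theorem Comp.natPair {f g : InputData → a.Val → ℕ} (hf : Comp (b := .nat) f)
    (hg : Comp (b := .nat) g) : Comp (b := .nat) fun D x => Nat.pair (f D x) (g D x) :=
  (Dec.nlt hf hg).ite (b := .nat) ((hg.nmul hg).nadd hf) (((hf.nmul hf).nadd hf).nadd hg)

/-- The elementary operations contain no square root, so the pairing is inverted by search. -/
theorem Comp.unpair_fst {f : InputData → a.Val → ℕ} (hf : Comp (b := .nat) f) :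
    Comp (b := .nat) fun D x => (f D x).unpair.1 := by
  have hid := Comp.id (a := .prod (.prod .nat .nat) .nat)
  have hid' := Comp.id (a := .prod .nat .nat)
  have h := Comp.find (a := .nat) (p := fun _ (j : ℕ) n => ∃ m < j + 1, Nat.pair n m = j)
    (Dec.bex (Dec.neq (hid.fst.snd.natPair hid.snd) hid.fst.fst) hid'.fst.succ)
    fun _ _ (j : ℕ) => ⟨j.unpair.1, j.unpair.2, Nat.lt_succ_of_le j.unpair_right_le, j.pair_unpair⟩
  have heq : ∀ j : ℕ, sInf {n | ∃ m < j + 1, Nat.pair n m = j} = j.unpair.1 := by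
    intro j
    obtain ⟨m, -, hm⟩ := Nat.sInf_mem (s := {n | ∃ m < j + 1, Nat.pair n m = j})
      ⟨j.unpair.1, j.unpair.2, Nat.lt_succ_of_le j.unpair_right_le, j.pair_unpair⟩
    simpa using congrArg (fun i => i.unpair.1) hm
  simp only [heq] at h
  exact h.comp hf

theorem Comp.unpair_snd {f : InputData → a.Val → ℕ} (hf : Comp (b := .nat) f) :
    Comp (b := .nat) fun D x => (f D x).unpair.2 := by
  have hid := Comp.id (a := .prod (.prod .nat .nat) .nat)
  have hid' := Comp.id (a := .prod .nat .nat)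
  have h := Comp.find (a := .nat) (p := fun _ (j : ℕ) m => ∃ n < j + 1, Nat.pair n m = j)
    (Dec.bex (Dec.neq (hid.snd.natPair hid.fst.snd) hid.fst.fst) hid'.fst.succ)
    fun _ _ (j : ℕ) => ⟨j.unpair.2, j.unpair.1, Nat.lt_succ_of_le j.unpair_left_le, j.pair_unpair⟩
  have heq : ∀ j : ℕ, sInf {m | ∃ n < j + 1, Nat.pair n m = j} = j.unpair.2 := by
    intro j
    obtain ⟨m, -, hm⟩ := Nat.sInf_mem (s := {m | ∃ n < j + 1, Nat.pair n m = j})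
      ⟨j.unpair.2, j.unpair.1, Nat.lt_succ_of_le j.unpair_left_le, j.pair_unpair⟩
    simpa using congrArg (fun i => i.unpair.2) hm
  simp only [heq] at h
  exact h.comp hf

/-- Expresses a binary digit by bounded quantifiers, addition and multiplication, avoiding division
of natural numbers. -/
theorem testBit_iff_exists (r i : ℕ) :
    r.testBit i = true ↔ ∃ q < r + 1, ∃ s < 2 ^ i, r = (2 * q + 1) * 2 ^ i + s := by
  rw [Nat.testBit_eq_decide_div_mod_eq, decide_eq_true_iff]
  have hpos : 0 < 2 ^ i := by positivity
  constructor
  · intro h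
    refine ⟨r / 2 ^ i / 2, ?_, r % 2 ^ i, Nat.mod_lt _ hpos, ?_⟩
    · exact Nat.lt_succ_of_le ((Nat.div_le_self _ _).trans (Nat.div_le_self _ _))
    · have h1 : 2 * (r / 2 ^ i / 2) + 1 = r / 2 ^ i := by omega
      rw [h1, Nat.div_add_mod']
  · rintro ⟨q, -, s, hs, hr⟩
    have : r / 2 ^ i = 2 * q + 1 := by
      rw [hr, add_comm, Nat.add_mul_div_right _ _ hpos, Nat.div_eq_of_lt hs, zero_add]
    omega

theorem Dec.testBit {f g : InputData → a.Val → ℕ} (hf : Comp (b := .nat) f)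
    (hg : Comp (b := .nat) g) : Dec fun D x => (f D x).testBit (g D x) = true := by
  have hid := Comp.id (a := .prod (.prod a .nat) .nat)
  have hid' := Comp.id (a := .prod a .nat)
  have h := Dec.bex (p := fun D x q => ∃ s < 2 ^ g D x, f D x = (2 * q + 1) * 2 ^ g D x + s)
    (Dec.bex (p := fun D (y : a.Val × ℕ) s => f D y.1 = (2 * y.2 + 1) * 2 ^ g D y.1 + s)
      (Dec.neq (hf.comp hid.fst.fst)
        (((((Comp.nconst 2).nmul hid.fst.snd).succ).nmul (hg.comp hid.fst.fst).two_pow).nadd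
          hid.snd))
      (hg.comp hid'.fst).two_pow) hf.succ
  exact h.congr fun D x => testBit_iff_exists _ _

end closure

/-! ### Coding of cuts and the finite greedy sequence -/

/-- The pair of subsets of `range N` that is coded by the binary digits of `r`. -/
def cut (N r : ℕ) : Finset ℕ × Finset ℕ :=
  ((range N).filter fun i => r.testBit i = true, (range N).filter fun i => r.testBit (N + i) = true)

theorem cut_mem_cutsBelow (N r : ℕ) : cut N r ∈ cutsBelow N :=
  ⟨fun _ h => mem_range.1 (mem_filter.1 h).1, fun _ h => mem_range.1 (mem_filter.1 h).1⟩

theorem cut_zero (N : ℕ) : cut N 0 = (∅, ∅) := by simp [cut]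

open Classical in
theorem exists_cut_eq {N : ℕ} {θ : Finset ℕ × Finset ℕ} (hθ : θ ∈ cutsBelow N) :
    ∃ r < 2 ^ (N + N), cut N r = θ := by
  set f : Fin (N + N) → Bool := fun i => decide (((i : ℕ) < N ∧ (i : ℕ) ∈ θ.1) ∨
    (N ≤ (i : ℕ) ∧ (i : ℕ) - N ∈ θ.2)) with hf
  refine ⟨Nat.ofBits f, Nat.ofBits_lt_two_pow f, Prod.ext ?_ ?_⟩
  · ext i
    simp only [cut, mem_filter, mem_range]
    constructor
    · rintro ⟨hi, h⟩
      rw [Nat.testBit_ofBits_lt f i (by omega)] at h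
      simp only [hf, decide_eq_true_eq] at h
      exact h.elim (fun h => h.2) (fun h => absurd hi (by omega))
    · intro h
      have hi := hθ.1 i h
      refine ⟨hi, ?_⟩
      rw [Nat.testBit_ofBits_lt f i (by omega)]
      simp [hf, hi, h]
  · ext i
    simp only [cut, mem_filter, mem_range]
    constructor
    · rintro ⟨hi, h⟩
      rw [Nat.testBit_ofBits_lt f (N + i) (by omega)] at h
      simp only [hf, decide_eq_true_eq] at h
      exact h.elim (fun h => absurd h.1 (by omega)) (fun h => by simpa using h.2)
    · intro h
      have hi := hθ.2 i h
      refine ⟨hi, ?_⟩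
      rw [Nat.testBit_ofBits_lt f (N + i) (by omega)]
      simp [hf, h]

open Classical in
/-- The minimum of `f r` over all `r < n` with `p r`. -/
noncomputable def minOver (f : ℕ → ℝ) (p : ℕ → Prop) (n : ℕ) : ℝ :=
  Nat.rec (f 0) (fun r acc => if p r ∧ ¬ acc ≤ f r then f r else acc) n

open Classical in
theorem minOver_succ (f : ℕ → ℝ) (p : ℕ → Prop) (n : ℕ) :
    minOver f p (n + 1) = if p n ∧ ¬ minOver f p n ≤ f n then f n else minOver f p n := rfl

theorem minOver_le {f : ℕ → ℝ} {p : ℕ → Prop} {n r : ℕ} (hr : r < n) (hp : p r) :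
    minOver f p n ≤ f r := by
  induction n with
  | zero => omega
  | succ n ih =>
    rw [minOver_succ]
    rcases Nat.lt_succ_iff_lt_or_eq.1 hr with h | rfl
    · split_ifs with h'
      · exact (le_of_not_ge h'.2).trans (ih h)
      · exact ih h
    · split_ifs with h'
      · exact le_rfl
      · by_contra hlt
        exact h' ⟨hp, hlt⟩

/-- The running minimum starts from `f 0`, a legitimate candidate only because `p 0` holds. In the
application, code 0 is the empty cut, which every link crosses. -/
theorem exists_minOver_eq (f : ℕ → ℝ) {p : ℕ → Prop} (h0 : p 0) (n : ℕ) :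
    ∃ r < n + 1, p r ∧ minOver f p (n + 1) = f r := by
  induction n with
  | zero => exact ⟨0, one_pos, h0, by simp [minOver]⟩
  | succ n ih =>
    rw [minOver_succ]
    split_ifs with h'
    · exact ⟨n + 1, by omega, h'.1, rfl⟩
    · obtain ⟨r, hr, hp, h⟩ := ih
      exact ⟨r, by omega, hp, h⟩

theorem isGLB_minOver (f : ℕ → ℝ) {p : ℕ → Prop} (h0 : p 0) {n : ℕ} (hn : 0 < n) :
    IsGLB {x | ∃ r < n, p r ∧ x = f r} (minOver f p n) := by
  obtain ⟨n, rfl⟩ := Nat.exists_eq_succ_of_ne_zero hn.ne'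
  refine IsLeast.isGLB ⟨exists_minOver_eq f h0 n, ?_⟩
  rintro x ⟨r, hr, hp, rfl⟩
  exact minOver_le hr hp

open Classical in
/-- The next term of the greedy sequence for the pairs of subsets of `range N`; the list `L`
contains the preceding terms in reverse order. -/
noncomputable def nextTerm (D : InputData) (N i : ℕ) (L : List ℝ) : ℝ :=
  if Link D i then
    minOver (fun r => slack D (fun j => L.getD (i - (j + 1)) 0) i (cut N r))
      (fun r => Indep D (cut N r) ∧ Cross D i (cut N r)) (2 ^ (N + N))
  else 0

/-- The first `i` terms, in reverse order, of the greedy sequence for the pairs of subsets of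
`range N`. -/
noncomputable def approxList (D : InputData) (N i : ℕ) : List ℝ :=
  Nat.rec [] (fun i L => nextTerm D N i L :: L) i

/-- The greedy sequence for the pairs of subsets of `range N`. -/
noncomputable def approx (D : InputData) (N i : ℕ) : ℝ := nextTerm D N i (approxList D N i)

theorem approxList_succ (D : InputData) (N i : ℕ) :
    approxList D N (i + 1) = approx D N i :: approxList D N i := rfl

theorem getD_approxList (D : InputData) (N : ℕ) {i j : ℕ} (hj : j < i) :
    (approxList D N i).getD (i - (j + 1)) 0 = approx D N j := by
  induction i with
  | zero => omega
  | succ i ih =>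
    rw [approxList_succ]
    rcases Nat.lt_succ_iff_lt_or_eq.1 hj with h | rfl
    -- New terms are put at the head, so the term j of a list of length i + 1 sits at index i - j.
    · rw [show i + 1 - (j + 1) = (i - (j + 1)) + 1 by omega, List.getD_cons_succ, ih h]
    · simp

theorem slack_congr {D : InputData} {c c' : ℕ → ℝ} {i : ℕ} (h : ∀ j < i, c j = c' j)
    (θ : Finset ℕ × Finset ℕ) : slack D c i θ = slack D c' i θ := by
  rw [slack, slack]
  congr 1
  exact sum_congr rfl fun j hj => by rw [h j (mem_range.1 hj)]

theorem isGreedy_approx (D : InputData) (N : ℕ) : IsGreedy D (cutsBelow N) (approx D N) := by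
  intro i
  refine ⟨fun hi => ?_, fun hi => by rw [approx, nextTerm, if_neg hi]⟩
  have hs : ∀ r, slack D (fun j => (approxList D N i).getD (i - (j + 1)) 0) i (cut N r)
      = slack D (approx D N) i (cut N r) :=
    fun r => slack_congr (fun j hj => getD_approxList D N hj) _
  rw [approx, nextTerm, if_pos hi]
  simp only [hs]
  convert isGLB_minOver (fun r => slack D (approx D N) i (cut N r))
    (p := fun r => Indep D (cut N r) ∧ Cross D i (cut N r))
    (by rw [cut_zero]; exact ⟨indep_empty, hi.cross_empty⟩)
    (show 0 < 2 ^ (N + N) by positivity) using 1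
  ext x
  constructor
  · rintro ⟨θ, hF, hθ, hc, rfl⟩
    obtain ⟨r, hr, rfl⟩ := exists_cut_eq hF
    exact ⟨r, hr, ⟨hθ, hc⟩, rfl⟩
  · rintro ⟨r, hr, ⟨hθ, hc⟩, rfl⟩
    exact ⟨cut N r, cut_mem_cutsBelow N r, hθ, hc, rfl⟩

/-! ### The output matrices -/

/-- The number of terms of the data that are read for the `k`-th matrix. -/
noncomputable def level (D : InputData) (k : ℕ) : ℕ :=
  sInf {N | k ≤ N ∧ (2 : ℝ) ^ (k + k) * tailMass D N ≤ 1}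

theorem Admissible.exists_level {D : InputData} (h : Admissible D) (k : ℕ) :
    ∃ N, k ≤ N ∧ (2 : ℝ) ^ (k + k) * tailMass D N ≤ 1 := by
  have h1 := h.tendsto_tailMass.const_mul ((2 : ℝ) ^ (k + k))
  rw [mul_zero] at h1
  exact ((eventually_ge_atTop k).and (h1.eventually (ge_mem_nhds one_pos))).exists

theorem Admissible.level_spec {D : InputData} (h : Admissible D) (k : ℕ) :
    k ≤ level D k ∧ (2 : ℝ) ^ (k + k) * tailMass D (level D k) ≤ 1 :=
  Nat.sInf_mem (h.exists_level k)

/-- The off-diagonal amounts of the `k`-th matrix. -/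
noncomputable def amount (D : InputData) (k j : ℕ) : ℝ :=
  (approxList D (level D k) k).getD (k - (j + 1)) 0

/-- The entry of the `k`-th matrix at the position coded by `i`, for `i < k`. -/
noncomputable def value (D : InputData) (k i : ℕ) : ℝ :=
  amount D k i + if i.unpair.1 = i.unpair.2 then
    D.mu i.unpair.1 - ∑ j ∈ range k, if j.unpair.1 = i.unpair.1 then amount D k j else 0
  else 0

/-- The list of the first `i` positions with their values in the `k`-th matrix. -/
noncomputable def output (D : InputData) (k i : ℕ) : List ((ℕ × ℕ) × ℝ) :=
  Nat.rec [] (fun i acc => ((i.unpair.1, i.unpair.2), value D k i) :: acc) i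

theorem entry_output (D : InputData) (k i : ℕ) (p : ℕ × ℕ) :
    entry (output D k i) p = if Nat.pair p.1 p.2 < i then value D k (Nat.pair p.1 p.2) else 0 := by
  induction i with
  | zero => simp [entry, output]
  | succ i ih =>
    have hout : output D k (i + 1) = ((i.unpair.1, i.unpair.2), value D k i) :: output D k i := rfl
    rw [hout, entry, List.lookup_cons]
    by_cases hp : Nat.pair p.1 p.2 = i
    · subst hp
      simp
    · have hne : (p == (i.unpair.1, i.unpair.2)) = false := by
        rw [beq_eq_false_iff_ne]
        rintro rfl
        exact hp (Nat.pair_unpair i)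
      rw [hne]
      have hlt : Nat.pair p.1 p.2 < i + 1 ↔ Nat.pair p.1 p.2 < i := by omega
      simp only [hlt]
      exact ih

/-! ### Programs for the matrices and for the threshold -/

section programs

variable {a : Ty}

theorem Dec.link {j : InputData → a.Val → ℕ} (hj : Comp (b := .nat) j) :
    Dec fun D x => Link D (j D x) :=
  (Dec.ord hj.unpair_fst hj.unpair_snd).and (Dec.neq hj.unpair_fst hj.unpair_snd).not

theorem Dec.mem_cut_fst {N r n : InputData → a.Val → ℕ} (hN : Comp (b := .nat) N)
    (hr : Comp (b := .nat) r) (hn : Comp (b := .nat) n) :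
    Dec fun D x => n D x ∈ (cut (N D x) (r D x)).1 :=
  ((Dec.nlt hn hN).and (Dec.testBit hr hn)).congr fun D x => by simp [cut]

theorem Dec.mem_cut_snd {N r n : InputData → a.Val → ℕ} (hN : Comp (b := .nat) N)
    (hr : Comp (b := .nat) r) (hn : Comp (b := .nat) n) :
    Dec fun D x => n D x ∈ (cut (N D x) (r D x)).2 :=
  ((Dec.nlt hn hN).and (Dec.testBit hr (hN.nadd hn))).congr fun D x => by simp [cut]

theorem Dec.cross {N r j : InputData → a.Val → ℕ} (hN : Comp (b := .nat) N)
    (hr : Comp (b := .nat) r) (hj : Comp (b := .nat) j) :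
    Dec fun D x => Cross D (j D x) (cut (N D x) (r D x)) :=
  (Dec.link hj).and ((Dec.mem_cut_fst hN hr hj.unpair_fst).not.and
    (Dec.mem_cut_snd hN hr hj.unpair_snd).not)

theorem Dec.indep {N r : InputData → a.Val → ℕ} (hN : Comp (b := .nat) N)
    (hr : Comp (b := .nat) r) : Dec fun D x => Indep D (cut (N D x) (r D x)) := by
  have h1 := Comp.id (a := .prod a .nat)
  have h2 := Comp.id (a := .prod (.prod a .nat) .nat)
  refine (Dec.ball (n := N) (p := fun D x m => m ∈ (cut (N D x) (r D x)).1 →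
      ∀ n < N D x, n ∈ (cut (N D x) (r D x)).2 → ¬ D.le m n)
    ((Dec.mem_cut_fst (hN.comp h1.fst) (hr.comp h1.fst) h1.snd).imp
      (Dec.ball (a := .prod a .nat) (n := fun D (y : a.Val × ℕ) => N D y.1) (p := fun D (y : a.Val × ℕ) n =>
          n ∈ (cut (N D y.1) (r D y.1)).2 → ¬ D.le y.2 n)
        ((Dec.mem_cut_snd (hN.comp h2.fst.fst) (hr.comp h2.fst.fst) h2.snd).imp
          (Dec.ord h2.fst.snd h2.snd).not) (hN.comp h1.fst))) hN).congr fun D x => ?_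
  have h := cut_mem_cutsBelow (N D x) (r D x)
  exact ⟨fun hi m _ hm n _ hn => hi m hm n hn,
    fun hi m hm n hn => hi m (h.1 m hm) hm n (h.2 n hn) hn⟩

theorem Comp.slack {v : InputData → a.Val → ℕ → ℝ} {i N r : InputData → a.Val → ℕ}
    (hv : Comp (a := .prod a .nat) (b := .real) fun D y => v D y.1 y.2)
    (hi : Comp (b := .nat) i) (hN : Comp (b := .nat) N) (hr : Comp (b := .nat) r) :
    Comp (b := .real) fun D x => slack D (v D x) (i D x) (cut (N D x) (r D x)) := by
  classical
  have h1 := Comp.id (a := .prod a .nat)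
  have hmu := Comp.sum_range (n := N)
    (f := fun D x n => if n ∈ (cut (N D x) (r D x)).1 then D.mu n else 0)
    ((Dec.mem_cut_fst (hN.comp h1.fst) (hr.comp h1.fst) h1.snd).ite (b := .real) h1.snd.mu
      Comp.rzero) hN
  have hnu := Comp.sum_range (n := N)
    (f := fun D x n => if n ∈ (cut (N D x) (r D x)).2 then D.nu n else 0)
    ((Dec.mem_cut_snd (hN.comp h1.fst) (hr.comp h1.fst) h1.snd).ite (b := .real) h1.snd.nu
      Comp.rzero) hN
  have hc := Comp.sum_range (n := i)
    (f := fun D x j => if Cross D j (cut (N D x) (r D x)) then v D x j else 0)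
    ((Dec.cross (hN.comp h1.fst) (hr.comp h1.fst) h1.snd).ite (b := .real) hv Comp.rzero) hi
  convert ((Comp.rone.rsub hmu).rsub hnu).rsub hc using 3 with D x
  rw [AlgComp.slack]
  have hsub : ∀ (A : Finset ℕ) (g : ℕ → ℝ), (∀ n ∈ A, n < N D x) →
      ∑ n ∈ A, g n = ∑ n ∈ range (N D x), if n ∈ A then g n else 0 := by
    intro A g hA
    rw [← sum_filter]
    refine sum_congr (Finset.ext fun n => ?_) fun _ _ => rfl
    simp only [mem_filter, mem_range]
    exact ⟨fun h => ⟨hA n h, h⟩, fun h => h.2⟩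
  rw [hsub _ _ (cut_mem_cutsBelow _ _).1, hsub _ _ (cut_mem_cutsBelow _ _).2]

theorem Comp.minOver {f : InputData → a.Val → ℕ → ℝ} {p : InputData → a.Val → ℕ → Prop}
    {n : InputData → a.Val → ℕ} (hf : Comp (a := .prod a .nat) (b := .real) fun D y => f D y.1 y.2)
    (hp : Dec (a := .prod a .nat) fun D y => p D y.1 y.2) (hn : Comp (b := .nat) n) :
    Comp (b := .real) fun D x => minOver (f D x) (p D x) (n D x) := by
  classical
  have hid := Comp.id (a := .prod a (.prod .nat .real))
  have hf' := hf.comp (hid.fst.pair hid.snd.fst)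
  exact Comp.natRec (b := .real)
    (g := fun D x r (acc : ℝ) => if p D x r ∧ ¬ acc ≤ f D x r then f D x r else acc)
    (hf.comp (Comp.id.pair (Comp.nconst 0)))
    (((hp.comp (hid.fst.pair hid.snd.fst)).and (Dec.rle hid.snd.snd hf').not).ite hf'
      hid.snd.snd) hn

theorem Comp.approxList {N i : InputData → a.Val → ℕ} (hN : Comp (b := .nat) N)
    (hi : Comp (b := .nat) i) :
    Comp (b := .list .real) fun D x => approxList D (N D x) (i D x) := by
  classical
  have hid := Comp.id (a := .prod a (.prod .nat (.list .real)))
  have h1 := Comp.id (a := .prod (.prod a (.prod .nat (.list .real))) .nat)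
  have h2 := Comp.id (a := .prod (.prod (.prod a (.prod .nat (.list .real))) .nat) .nat)
  have hnext : Comp (a := .prod a (.prod .nat (.list .real))) (b := .real)
      fun D y => nextTerm D (N D y.1) y.2.1 y.2.2 :=
    (Dec.link hid.snd.fst).ite (b := .real)
      (Comp.minOver
        (f := fun D (y : a.Val × ℕ × List ℝ) r =>
          AlgComp.slack D (fun j => y.2.2.getD (y.2.1 - (j + 1)) 0) y.2.1 (cut (N D y.1) r))
        (p := fun D (y : a.Val × ℕ × List ℝ) r =>
          Indep D (cut (N D y.1) r) ∧ Cross D y.2.1 (cut (N D y.1) r))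
        (Comp.slack (v := fun D (y : (a.Val × ℕ × List ℝ) × ℕ) j =>
            y.1.2.2.getD (y.1.2.1 - (j + 1)) 0)
          (h2.fst.fst.snd.snd.getD (h2.fst.fst.snd.fst.nsub h2.snd.succ))
          h1.fst.snd.fst (hN.comp h1.fst.fst) h1.snd)
        ((Dec.indep (hN.comp h1.fst.fst) h1.snd).and
          (Dec.cross (hN.comp h1.fst.fst) h1.snd h1.fst.snd.fst))
        ((hN.comp hid.fst).nadd (hN.comp hid.fst)).two_pow)
      Comp.rzero
  exact Comp.natRec (b := .list .real)
    (g := fun D x i (L : List ℝ) => nextTerm D (N D x) i L :: L) Comp.nil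
    (hnext.cons hid.snd.snd) hi

theorem Comp.tailMass {N : InputData → a.Val → ℕ} (hN : Comp (b := .nat) N) :
    Comp (b := .real) fun D x => tailMass D (N D x) := by
  have h1 := Comp.id (a := .prod a .nat)
  have h := (Comp.rone.radd Comp.rone).rsub
    (Comp.sum_range (f := fun D _ n => D.mu n + D.nu n) (h1.snd.mu.radd h1.snd.nu) hN)
  simp only [one_add_one_eq_two] at h
  exact h

theorem Comp.level : Comp (a := .nat) (b := .nat) fun D k => level D k := by
  have h1 := Comp.id (a := .prod .nat .nat)
  exact Comp.find (a := .nat)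
    (p := fun D (k : ℕ) N => k ≤ N ∧ (2 : ℝ) ^ (k + k) * AlgComp.tailMass D N ≤ 1)
    ((Dec.nle h1.fst h1.snd).and
      (Dec.rle ((h1.fst.nadd h1.fst).rtwo_pow.rmul h1.snd.tailMass) Comp.rone))
    fun D hD k => hD.exists_level k

theorem Comp.amount {k j : InputData → a.Val → ℕ} (hk : Comp (b := .nat) k)
    (hj : Comp (b := .nat) j) : Comp (b := .real) fun D x => amount D (k D x) (j D x) :=
  (Comp.approxList (Comp.level.comp hk) hk).getD (hk.nsub hj.succ)

theorem Comp.value {k i : InputData → a.Val → ℕ} (hk : Comp (b := .nat) k)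
    (hi : Comp (b := .nat) i) : Comp (b := .real) fun D x => value D (k D x) (i D x) := by
  have h1 := Comp.id (a := .prod a .nat)
  have hi' := hi.comp h1.fst
  exact (Comp.amount hk hi).radd ((Dec.neq hi.unpair_fst hi.unpair_snd).ite (b := .real)
    (hi.unpair_fst.mu.rsub (Comp.sum_range (f := fun D x j =>
        if j.unpair.1 = (i D x).unpair.1 then AlgComp.amount D (k D x) j else 0)
      ((Dec.neq h1.snd.unpair_fst hi'.unpair_fst).ite (b := .real)
        (Comp.amount (hk.comp h1.fst) h1.snd) Comp.rzero) hk)) Comp.rzero)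

theorem Comp.output : Comp (a := .nat) (b := .matrix) fun D (k : ℕ) => output D k k := by
  have hid := Comp.id (a := .prod .nat (.prod .nat .matrix))
  exact Comp.natRec (b := .matrix) (g := fun D (k : ℕ) i (acc : List ((ℕ × ℕ) × ℝ)) =>
      ((i.unpair.1, i.unpair.2), AlgComp.value D k i) :: acc) Comp.nil
    (((hid.snd.fst.unpair_fst.pair hid.snd.fst.unpair_snd).pair
      (Comp.value hid.fst hid.snd.fst)).cons hid.snd.snd) Comp.id

/-- A threshold for the accuracy `ε` at the position `(n, m)`. -/
noncomputable def threshold (n m : ℕ) (ε : ℝ) : ℕ :=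
  sInf {K : ℕ | ε ≤ 0 ∨ 1 ≤ ε * 2 ^ K} + Nat.pair n m + 1

/-- The alternative ε ≤ 0 lets the search for K halt on every real input, as `Comp` requires. -/
theorem exists_one_le_mul_two_pow (ε : ℝ) : ∃ K : ℕ, ε ≤ 0 ∨ 1 ≤ ε * 2 ^ K := by
  rcases le_or_gt ε 0 with h | h
  · exact ⟨0, Or.inl h⟩
  · obtain ⟨K, hK⟩ := pow_unbounded_of_one_lt (1 / ε) (one_lt_two (α := ℝ))
    refine ⟨K, Or.inr ?_⟩
    rw [div_lt_iff₀ h] at hK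
    linarith

theorem Comp.threshold : Comp (a := .prod (.prod .nat .nat) .real) (b := .nat)
    fun _ x => threshold x.1.1 x.1.2 x.2 := by
  have hid := Comp.id (a := .prod (.prod .nat .nat) .real)
  have h1 := Comp.id (a := .prod (.prod (.prod .nat .nat) .real) .nat)
  exact ((Comp.find (a := .prod (.prod .nat .nat) .real)
    (p := fun _ (x : (ℕ × ℕ) × ℝ) K => x.2 ≤ 0 ∨ 1 ≤ x.2 * 2 ^ K)
    ((Dec.rle h1.fst.snd Comp.rzero).or (Dec.rle Comp.rone (h1.fst.snd.rmul h1.snd.rtwo_pow)))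
    fun _ _ x => exists_one_le_mul_two_pow x.2).nadd (hid.fst.fst.natPair hid.fst.snd)).succ

end programs

/-! ### Convergence to the limit matrix -/

theorem amount_eq_approx {k j : ℕ} (hj : j < k) : amount D k j = approx D (level D k) j :=
  getD_approxList D _ hj

/-- The errors add up to at most 2^k times the tail mass, and `level` makes the tail mass at most
4^(-k). -/
theorem Admissible.sum_abs_amount_sub_le (h : Admissible D) (k : ℕ) :
    ∑ j ∈ range k, |amount D k j - greedy D j| ≤ (1 / 2) ^ k := by
  obtain ⟨h1, h2⟩ := h.level_spec k
  have ht := h.tailMass_nonneg (level D k)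
  calc ∑ j ∈ range k, |amount D k j - greedy D j|
      ≤ ∑ j ∈ range k, 2 ^ j * tailMass D (level D k) := by
        refine sum_le_sum fun j hj => ?_
        have hj := mem_range.1 hj
        rw [amount_eq_approx hj]
        exact h.abs_sub_greedy_le (isGreedy_approx D _) j (hj.trans_le h1)
    _ = (2 ^ k - 1) * tailMass D (level D k) := by
        rw [← sum_mul, geom_sum_eq (by norm_num)]; norm_num
    _ ≤ 2 ^ k * tailMass D (level D k) := by gcongr; linarith
    _ ≤ (1 / 2) ^ k := by
        rw [one_div_pow, le_div_iff₀ (by positivity)]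
        calc _ = (2 : ℝ) ^ (k + k) * tailMass D (level D k) := by ring
          _ ≤ 1 := h2

theorem Admissible.abs_amount_sub_le (h : Admissible D) {k j : ℕ} (hj : j < k) :
    |amount D k j - greedy D j| ≤ (1 / 2) ^ k :=
  (single_le_sum (f := fun j => |amount D k j - greedy D j|) (fun _ _ => abs_nonneg _)
    (mem_range.2 hj)).trans (h.sum_abs_amount_sub_le k)

/-- The limit matrix, as a function of the coded position. -/
noncomputable def limValue (D : InputData) (i : ℕ) : ℝ :=
  greedy D i + if i.unpair.1 = i.unpair.2 then muRes D i.unpair.1 else 0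

/-- The `k`-th matrix, as a function of the coded position. -/
noncomputable def stageValue (D : InputData) (k i : ℕ) : ℝ := if i < k then value D k i else 0

theorem Admissible.summable_limValue (h : Admissible D) : Summable (limValue D) :=
  h.summable_greedy.add (hasSum_ite_diag h.hasSum_muRes).summable

theorem Admissible.limValue_nonneg (h : Admissible D) (i : ℕ) : 0 ≤ limValue D i := by
  have h1 := h.greedy_nonneg i
  have h2 := h.muRes_nonneg i.unpair.1
  rw [limValue]
  split_ifs <;> linarith

theorem Admissible.hasSum_limValue (h : Admissible D) : HasSum (limValue D) 1 := by
  have h1 := h.summable_greedy.hasSum.add (hasSum_ite_diag h.hasSum_muRes)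
  rw [add_sub_cancel] at h1
  exact h1

theorem summable_stageValue (k : ℕ) : Summable (stageValue D k) :=
  summable_of_ne_finset_zero (s := range k) fun i hi => if_neg (by simpa using hi)

/-- What the `k`-th matrix sends from `n` to other places. -/
noncomputable def sent (D : InputData) (k n : ℕ) : ℝ :=
  ∑ j ∈ range k, if j.unpair.1 = n then amount D k j else 0

theorem Admissible.tendsto_sent (h : Admissible D) (n : ℕ) :
    Tendsto (fun k => sent D k n) atTop (𝓝 (row (greedy D) n)) := by
  have h1 := (hasSum_ite_row h.summable_greedy n).tendsto_sum_nat
  have h2 : Tendsto (fun k : ℕ => ((1 : ℝ) / 2) ^ k) atTop (𝓝 0) :=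
    tendsto_pow_atTop_nhds_zero_of_lt_one (by norm_num) (by norm_num)
  have h3 : Tendsto (fun k => sent D k n - ∑ j ∈ range k, if j.unpair.1 = n then greedy D j else 0)
      atTop (𝓝 0) := by
    refine squeeze_zero_norm (fun k => ?_) h2
    rw [sent, ← sum_sub_distrib]
    refine (norm_sum_le _ _).trans (le_trans (sum_le_sum fun j _ => ?_)
      (h.sum_abs_amount_sub_le k))
    split_ifs
    · exact le_rfl
    · simp
  simpa using h3.add h1

/-- A bound independent of k and summable over n, needed to dominate the diagonal. A term j < k has
error at most 2^(-k) ≤ 2^(-j); a term j ≥ k is missing and has error `greedy D j`. -/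
theorem Admissible.abs_sent_sub_le (h : Admissible D) (k n : ℕ) :
    |sent D k n - row (greedy D) n| ≤ row (fun j => (1 / 2) ^ j + greedy D j) n := by
  have hs : Summable fun j => ((1 : ℝ) / 2) ^ j + greedy D j :=
    summable_geometric_two.add h.summable_greedy
  have h1 : HasSum (fun j => if j < k then (if j.unpair.1 = n then amount D k j else 0) else 0)
      (sent D k n) := by
    have := hasSum_sum_of_ne_finset_zero (s := range k)
      (L := SummationFilter.unconditional ℕ)
      (f := fun j => if j < k then (if j.unpair.1 = n then amount D k j else 0) else 0)
      fun j hj => if_neg (by simpa using hj)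
    convert this using 1
    exact sum_congr rfl fun j hj => (if_pos (mem_range.1 hj)).symm
  have h2 := h1.sub (hasSum_ite_row h.summable_greedy n)
  rw [← h2.tsum_eq, ← Real.norm_eq_abs]
  refine tsum_of_norm_bounded (hasSum_ite_row hs n) fun j => ?_
  have hg := h.greedy_nonneg j
  have hp : (0 : ℝ) ≤ (1 / 2) ^ j := by positivity
  rw [Real.norm_eq_abs]
  by_cases hn : j.unpair.1 = n
  · by_cases hj : j < k
    · simp only [hn, hj, if_true]
      have := h.abs_amount_sub_le hj
      have : ((1 : ℝ) / 2) ^ k ≤ (1 / 2) ^ j :=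
        pow_le_pow_of_le_one (by norm_num) (by norm_num) hj.le
      linarith
    · simp only [hn, hj, if_true, if_false, zero_sub, abs_neg, abs_of_nonneg hg]
      linarith
  · simp [hn]

theorem stageValue_of_lt {k i : ℕ} (hi : i < k) : stageValue D k i = amount D k i +
    if i.unpair.1 = i.unpair.2 then D.mu i.unpair.1 - sent D k i.unpair.1 else 0 := if_pos hi

theorem Admissible.tendsto_stageValue (h : Admissible D) (i : ℕ) :
    Tendsto (fun k => stageValue D k i) atTop (𝓝 (limValue D i)) := by
  have h1 : Tendsto (fun k => amount D k i) atTop (𝓝 (greedy D i)) := by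
    rw [← tendsto_sub_nhds_zero_iff]
    refine squeeze_zero_norm' ?_ (tendsto_pow_atTop_nhds_zero_of_lt_one
      (show (0 : ℝ) ≤ 1 / 2 by norm_num) (by norm_num))
    filter_upwards [eventually_gt_atTop i] with k hk
    exact h.abs_amount_sub_le hk
  have h2 : Tendsto (fun k => amount D k i +
      if i.unpair.1 = i.unpair.2 then D.mu i.unpair.1 - sent D k i.unpair.1 else 0) atTop
      (𝓝 (limValue D i)) := by
    refine h1.add ?_
    split_ifs
    · exact (h.tendsto_sent _).const_sub _
    · exact tendsto_const_nhds
  refine h2.congr' ?_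
  filter_upwards [eventually_gt_atTop i] with k hk
  exact (stageValue_of_lt hk).symm

theorem Admissible.tendsto_tsum_abs (h : Admissible D) :
    Tendsto (fun k => ∑' i, |stageValue D k i - limValue D i|) atTop (𝓝 0) := by
  have hs : Summable fun j => ((1 : ℝ) / 2) ^ j + greedy D j :=
    summable_geometric_two.add h.summable_greedy
  have hrow : ∀ n, 0 ≤ row (fun j => ((1 : ℝ) / 2) ^ j + greedy D j) n := fun n =>
    tsum_nonneg fun m => add_nonneg (by positivity) (h.greedy_nonneg _)
  rw [← tsum_zero (α := ℝ) (β := ℕ)]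
  -- The first summand dominates positions not yet listed. The others dominate the listed ones: the
  -- geometric term the error of the amount, the row sums the error of what was sent from a diagonal
  -- position.
  refine tendsto_tsum_of_dominated_convergence
    (bound := fun i => limValue D i + ((1 / 2) ^ i + if i.unpair.1 = i.unpair.2 then
      row (fun j => (1 / 2) ^ j + greedy D j) i.unpair.1 else 0))
    (h.summable_limValue.add (summable_geometric_two.add (hasSum_ite_diag (hasSum_rows hs)).summable))
    (fun i => ?_) (Eventually.of_forall fun k i => ?_)
  · simpa using ((h.tendsto_stageValue i).sub_const (limValue D i)).abs
  · rw [Real.norm_eq_abs, abs_abs]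
    have hl := h.limValue_nonneg i
    have hp : (0 : ℝ) ≤ (1 / 2) ^ i := by positivity
    by_cases hi : i < k
    · have h1 := h.abs_amount_sub_le hi
      have h2 : ((1 : ℝ) / 2) ^ k ≤ (1 / 2) ^ i :=
        pow_le_pow_of_le_one (by norm_num) (by norm_num) hi.le
      rw [stageValue_of_lt hi]
      have h3 : amount D k i + (if i.unpair.1 = i.unpair.2 then
            D.mu i.unpair.1 - sent D k i.unpair.1 else 0) - limValue D i
          = (amount D k i - greedy D i) + if i.unpair.1 = i.unpair.2 then
            -(sent D k i.unpair.1 - row (greedy D) i.unpair.1) else 0 := by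
        rw [limValue, muRes]
        split_ifs <;> ring
      rw [h3]
      refine (abs_add_le _ _).trans ?_
      have h4 := h.abs_sent_sub_le k i.unpair.1
      split_ifs
      · rw [abs_neg]; linarith
      · rw [abs_zero]; linarith
    · have := hrow i.unpair.1
      rw [stageValue, if_neg hi, zero_sub, abs_neg, abs_of_nonneg hl]
      split_ifs <;> linarith

/-! ### Matrices in ℓ¹ and their marginals -/

/-- The summable matrix with the entry `f (Nat.pair n m)` at the position `(n, m)`. -/
noncomputable def toMatrix (f : ℕ → ℝ) (hf : Summable f) : lp (fun _ : ℕ × ℕ => ℝ) 1 :=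
  ⟨fun p => f (Nat.pair p.1 p.2), memℓp_gen (by simpa using (summable_pair hf).abs)⟩

theorem toMatrix_apply (f : ℕ → ℝ) (hf : Summable f) (p : ℕ × ℕ) :
    toMatrix f hf p = f (Nat.pair p.1 p.2) := rfl

theorem norm_toMatrix_sub {f g : ℕ → ℝ} (hf : Summable f) (hg : Summable g) :
    ‖toMatrix f hf - toMatrix g hg‖ = ∑' i, |f i - g i| := by
  rw [lp.norm_eq_tsum_rpow (by simp)]
  simp only [ENNReal.toReal_one, Real.rpow_one, div_one, lp.coeFn_sub, Pi.sub_apply, toMatrix_apply,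
    Real.norm_eq_abs]
  exact Nat.pairEquiv.tsum_eq fun i => |f i - g i|

theorem limValue_pair (n m : ℕ) :
    limValue D (Nat.pair n m) = greedy D (Nat.pair n m) + if n = m then muRes D n else 0 := by
  simp [limValue]

theorem Admissible.hasSum_limValue_row (h : Admissible D) (n : ℕ) :
    HasSum (fun m => limValue D (Nat.pair n m)) (D.mu n) := by
  have h1 := (hasSum_row h.summable_greedy n).add
    (hasSum_single (f := fun m => if n = m then muRes D n else 0) n fun m hm => if_neg hm.symm)
  simpa [limValue_pair, muRes] using h1

/-- The diagonal was filled with the residues of the sources; the columns come out right because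
these equal the residues of the targets. -/
theorem Admissible.hasSum_limValue_col (h : Admissible D) (m : ℕ) :
    HasSum (fun n => limValue D (Nat.pair n m)) (D.nu m) := by
  have h1 := (hasSum_col h.summable_greedy m).add
    (hasSum_single (f := fun n => if n = m then muRes D n else 0) m fun n hn => if_neg hn)
  simpa [limValue_pair, h.muRes_eq_nuRes m, nuRes] using h1

theorem Admissible.abs_stageValue_sub_le (h : Admissible D) {n m k : ℕ} (hnm : n ≠ m) {ε : ℝ}
    (hε : 0 < ε) (hk : threshold n m ε ≤ k) :
    |stageValue D k (Nat.pair n m) - limValue D (Nat.pair n m)| ≤ ε := by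
  have hK : 1 ≤ ε * 2 ^ sInf {K : ℕ | ε ≤ 0 ∨ 1 ≤ ε * 2 ^ K} :=
    (Nat.sInf_mem (exists_one_le_mul_two_pow ε)).resolve_left hε.not_ge
  rw [threshold] at hk
  set K := sInf {K : ℕ | ε ≤ 0 ∨ 1 ≤ ε * 2 ^ K}
  -- The threshold exceeds the code of the position, so the entry is already listed at stage k.
  have hi : Nat.pair n m < k := by omega
  rw [stageValue_of_lt hi, limValue_pair]
  simp only [Nat.unpair_pair, hnm, if_false, add_zero]
  calc _ ≤ ((1 : ℝ) / 2) ^ k := h.abs_amount_sub_le hi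
    _ ≤ (1 / 2) ^ K := pow_le_pow_of_le_one (by norm_num) (by norm_num) (by omega)
    _ ≤ ε := by rwa [one_div_pow, div_le_iff₀ (by positivity)]

end AlgComp

theorem theoremY12 :
    ∃ (P : AlgComp.Prog .nat .matrix) (Q : AlgComp.Prog (.prod (.prod .nat .nat) .real) .nat),
      ∀ (μ ν : ℕ → ℝ) (le : ℕ → ℕ → Prop),
        (∀ n, le n n) →
        (∀ n m, le n m → le m n → n = m) →
        (∀ l n m, le l n → le n m → le l m) →
        (∀ n, 0 ≤ μ n) → (∀ n, 0 ≤ ν n) → HasSum μ 1 → HasSum ν 1 →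
        (∀ R : Set ℕ, AlgComp.UpwardClosed le R → ∑' n : R, μ n ≤ ∑' n : R, ν n) →
        ∃ (Δ : ℕ → lp (fun _ : ℕ × ℕ => ℝ) 1) (Λ : lp (fun _ : ℕ × ℕ => ℝ) 1),
          -- each matrix of the sequence is computed in finitely many operations
          (∀ k : ℕ, ∃ (l : List ((ℕ × ℕ) × ℝ)) (t : ℕ),
            AlgComp.Run ⟨μ, ν, le⟩ P k l t ∧ ∀ p : ℕ × ℕ, Δ k p = AlgComp.entry l p) ∧
          -- convergence in the norm of the space of summable matrices
          Tendsto Δ atTop (𝓝 Λ) ∧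
          -- the limit solves the problem
          (∀ n m, 0 ≤ Λ (n, m)) ∧
          HasSum (fun p : ℕ × ℕ => Λ p) 1 ∧
          (∀ n m, Λ (n, m) ≠ 0 → le n m) ∧
          (∀ n, HasSum (fun m => Λ (n, m)) (μ n)) ∧
          (∀ m, HasSum (fun n => Λ (n, m)) (ν m)) ∧
          -- computable control of the speed of pointwise convergence off the diagonal
          (∀ n m, le n m → n ≠ m → ∀ ε : ℝ, 0 < ε → ∃ k₀ t : ℕ,
            AlgComp.Run ⟨μ, ν, le⟩ Q ((n, m), ε) k₀ t ∧
              ∀ k ≥ k₀, |Δ k (n, m) - Λ (n, m)| ≤ ε) := by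
  obtain ⟨P, hP⟩ := AlgComp.Comp.output
  obtain ⟨Q, hQ⟩ := AlgComp.Comp.threshold
  refine ⟨P, Q, fun μ ν le hrefl hanti htrans hμ hν hμ1 hν1 hdom => ?_⟩
  have h : AlgComp.Admissible ⟨μ, ν, le⟩ := ⟨hrefl, hanti, htrans, hμ, hν, hμ1, hν1, hdom⟩
  refine ⟨fun k => AlgComp.toMatrix _ (AlgComp.summable_stageValue (D := ⟨μ, ν, le⟩) k),
    AlgComp.toMatrix _ h.summable_limValue, fun k => ?_, ?_, fun n m => h.limValue_nonneg _, ?_,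
    fun n m hne => ?_, h.hasSum_limValue_row, h.hasSum_limValue_col, fun n m _ hnm ε hε => ?_⟩
  · obtain ⟨t, ht⟩ := hP _ h k
    exact ⟨_, t, ht, fun p => (AlgComp.entry_output _ k k p).symm⟩
  · rw [tendsto_iff_norm_sub_tendsto_zero]
    simp only [AlgComp.norm_toMatrix_sub]
    exact h.tendsto_tsum_abs
  · exact (Nat.pairEquiv.hasSum_iff (f := AlgComp.limValue ⟨μ, ν, le⟩)).2 h.hasSum_limValue
  · by_contra hle
    refine hne ?_
    -- By reflexivity a violation can only occur off the diagonal, where the entry is a greedy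
    -- amount and vanishes unless the pair is a link.
    have hnm : n ≠ m := fun hnm => hle (hnm ▸ hrefl n)
    rw [AlgComp.toMatrix_apply, AlgComp.limValue_pair, if_neg hnm, add_zero]
    refine (h.isGreedy_greedy _).2 fun hL => hle ?_
    simpa using hL.1
  · obtain ⟨t, ht⟩ := hQ _ h ((n, m), ε)
    exact ⟨_, t, ht, fun k hk => h.abs_stageValue_sub_le hnm hε hk⟩
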